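/- Let $d\ge 1$ and write $\mathbb 1$ for the identity operator on $\mathbb C^d$ and $\|X\|_F=\sqrt{\operatorname{tr}(X^\dagger X)}$. A quantum channel is a completely positive trace-preserving linear map $\Lambda$ on $d\times d$ complex matrices; its Choi matrix is $M^\Lambda=(\mathbb 1\otimes\Lambda)(|\Omega\rangle\langle\Omega|)$ with $|\Omega\rangle=\sum_{n=1}^d|n\rangle\otimes|n\rangle$. For a bipartite operator $X$ let $\phi_X=d^{-1}\operatorname{tr}_1X$, so that $\phi_{M^\Lambda}=\Lambda(\mathbb 1/d)$, and put $g_M(X,Y)=\operatorname{tr}(\phi_M^{-1}\phi_X\phi_M^{-1}\phi_Y)$. The geometric complexity of $\Lambda$ is $$\mathcal C(\Lambda)=\inf\int_0^1\sqrt{g_{M_t}(\dot M_t,\dot M_t)}\,dt\in[0,\infty],$$ the infimum being over all continuous paths of quantum channels $(\Lambda_t)_{0\le t\le1}$ from the identity channel $\mathsf{Id}$ to $\Lambda$ whose Choi matrices $M_t=M^{\Lambda_t}$ are differentiable in $t$ except at countably many $t$; the integrand is $+\infty$ where $\phi_{M_t}$ is singular. For positive definite $A,B$ let $\mathcal D(A,B)$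 be the infimum of $\int_0^1\sqrt{\operatorname{tr}(O_t^{-1}\dot O_tO_t^{-1}\dot O_t)}\,dt$ over all continuous paths $(O_t)_{0\le t\le 1}$ of positive definite operators from $A$ to $B$, differentiable except at countably many $t$ (no trace constraint). Then: (1) For every quantum channel $\Lambda$, $\ell\le\mathcal C(\Lambda)\le(\sqrt d+1)\,\ell$, where $\ell=\|(\ln d)\mathbb 1+\ln\Lambda(\mathbb 1/d)\|_F$ if $\Lambda(\mathbb 1/d)$ has full rank and $\ell=\infty$ otherwise. (2) For all positive definite $A,B$, $\mathcal D(A,B)=\|\ln(A^{-1/2}BA^{-1/2})\|_F$, and the infimum is attained by a smooth path. (3) Let $\Lambda$ be a quantum channel such that $\Lambda(\mathbb 1/d)$ has full rank, and let $(\phi_t)_{0\le t\le1}$ be a smooth path of positive definite density operators from $\mathbb 1/d$ to $\Lambda(\mathbb 1/d)$. Then there is a continuous path of quantum channels $(\Lambda_t)_{0\le t\le1}$ from $\mathsf{Id}$ to $\Lambda$ with $\Lambda_t(\mathbb 1/d)=\phi_t$ for all $t\in[0,1]$. -/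

import Mathlib

open scoped ENNReal ContDiff Matrix ComplexOrder
open Set MeasureTheory

noncomputable section

/-- Operators on the Hilbert space `ℂ^d`. -/
abbrev Op (d : ℕ) : Type := Matrix (Fin d) (Fin d) ℂ

/-- Operators on the bipartite space `ℂ^k ⊗ ℂ^d`; the first index belongs to the first factor. -/
abbrev BiOp (k d : ℕ) : Type := Matrix (Fin k × Fin d) (Fin k × Fin d) ℂ

/-- Linear maps on operators. -/
abbrev SuperOp (d : ℕ) : Type := Op d →ₗ[ℂ] Op d

/-- The maximally mixed state `𝟙 / d`. -/
def maxMixed (d : ℕ) : Op d := (d : ℂ)⁻¹ • (1 : Op d)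

/-- The Frobenius norm `√(tr (X† X))`. -/
def frobNorm {d : ℕ} (X : Op d) : ℝ := Real.sqrt (Matrix.trace (Xᴴ * X)).re

/-- The map `𝟙 ⊗ Λ` on operators on `ℂ^k ⊗ ℂ^d`: `Λ` acts on each `d × d` block. -/
def ampliation {d : ℕ} (k : ℕ) (Λ : SuperOp d) (X : BiOp k d) : BiOp k d :=
  Matrix.of fun p q => Λ (Matrix.of fun i j => X (p.1, i) (q.1, j)) p.2 q.2

/-- Quantum channels: completely positive, trace preserving linear maps. -/
structure IsQuantumChannel {d : ℕ} (Λ : SuperOp d) : Prop where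
  completely_positive :
    ∀ (k : ℕ) (X : BiOp k d), X.PosSemidef → (ampliation k Λ X).PosSemidef
  trace_preserving : ∀ X : Op d, (Λ X).trace = X.trace

/-- The unnormalized maximally entangled vector `|Ω⟩ = ∑ₙ |n⟩ ⊗ |n⟩`. -/
def omegaVec (d : ℕ) : Fin d × Fin d → ℂ := fun p => if p.1 = p.2 then 1 else 0

/-- The Choi matrix `(𝟙 ⊗ Λ)(|Ω⟩⟨Ω|)`. -/
def choi {d : ℕ} (Λ : SuperOp d) : BiOp d d :=
  ampliation d Λ (Matrix.vecMulVec (omegaVec d) (star (omegaVec d)))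

/-- The reduced operator `φ_X = d⁻¹ tr₁ X`. -/
def reduced {d : ℕ} (X : BiOp d d) : Op d :=
  (d : ℂ)⁻¹ • Matrix.of fun i j => ∑ k : Fin d, X (k, i) (k, j)

/-- The metric `tr (P⁻¹ X P⁻¹ Y)` at a positive definite operator `P`; for Hermitian `X`, `Y`
the trace is a real number. -/
def opMetric {d : ℕ} (P X Y : Op d) : ℝ := (Matrix.trace (P⁻¹ * X * P⁻¹ * Y)).re

/-- The metric `g_M(X, Y) = tr (φ_M⁻¹ φ_X φ_M⁻¹ φ_Y)` on Choi matrices. -/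
def choiMetric {d : ℕ} (M X Y : BiOp d d) : ℝ :=
  opMetric (reduced M) (reduced X) (reduced Y)

/-- Existence of the velocity of a matrix-valued path on `[0, 1]`, except perhaps at countably many
parameters (in particular, corners are allowed). -/
def HasVelocity {ι : Type} (M : ℝ → Matrix ι ι ℂ) : Prop :=
  ∃ S : Set ℝ, S.Countable ∧ ∀ t ∈ Ioo (0 : ℝ) 1 \ S, DifferentiableAt ℝ M t

/-- Smoothness on `[0, 1]` of a matrix-valued path (entrywise). -/
def SmoothPath {d : ℕ} (φ : ℝ → Op d) : Prop :=
  ∀ i j, ContDiffOn ℝ ∞ (fun t => φ t i j) (Icc 0 1)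

/-- Continuous paths of quantum channels on `[0, 1]` from `Λ₀` to `Λ₁`. -/
structure IsChannelPath {d : ℕ} (Λ₀ Λ₁ : SuperOp d) (Γ : ℝ → SuperOp d) : Prop where
  channel : ∀ t ∈ Icc (0 : ℝ) 1, IsQuantumChannel (Γ t)
  continuousOn : ContinuousOn (fun t => choi (Γ t)) (Icc 0 1)
  source : Γ 0 = Λ₀
  target : Γ 1 = Λ₁

open Classical in
/-- The speed `√g_{M_t}(Ṁ_t, Ṁ_t)` of a path of Choi matrices. It is infinite at points where
`φ_{M_t}` is singular, so that the metric is not defined. -/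
def choiSpeed {d : ℕ} (M : ℝ → BiOp d d) (t : ℝ) : ℝ≥0∞ :=
  if (reduced (M t)).PosDef then
    ENNReal.ofReal (Real.sqrt (choiMetric (M t) (deriv M t) (deriv M t)))
  else ⊤

/-- The length of a path of Choi matrices. -/
def choiLength {d : ℕ} (M : ℝ → BiOp d d) : ℝ≥0∞ := ∫⁻ t in Icc (0 : ℝ) 1, choiSpeed M t

/-- The geometric complexity of `Λ`: the infimum of the lengths of the continuous paths of quantum
channels from the identity channel to `Λ` (those whose Choi matrices have a velocity). -/
def complexity {d : ℕ} (Λ : SuperOp d) : ℝ≥0∞ :=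
  ⨅ (Γ : ℝ → SuperOp d) (_ : IsChannelPath LinearMap.id Λ Γ)
    (_ : HasVelocity fun t => choi (Γ t)), choiLength fun t => choi (Γ t)

open Classical in
/-- `ℓ = ‖ln d + ln Λ(𝟙/d)‖_F`, which is `∞` if `Λ(𝟙/d)` has a zero eigenvalue. -/
def logNorm {d : ℕ} (Λ : SuperOp d) : ℝ≥0∞ :=
  if (Λ (maxMixed d)).PosDef then
    ENNReal.ofReal
      (frobNorm (((Real.log d : ℝ) : ℂ) • (1 : Op d) + cfc Real.log (Λ (maxMixed d))))
  else ⊤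

/-- Continuous paths of positive definite operators on `[0, 1]` from `A` to `B`, with a velocity. -/
structure IsPosDefPath {d : ℕ} (A B : Op d) (O : ℝ → Op d) : Prop where
  posDef : ∀ t ∈ Icc (0 : ℝ) 1, (O t).PosDef
  continuousOn : ContinuousOn O (Icc 0 1)
  hasVelocity : HasVelocity O
  source : O 0 = A
  target : O 1 = B

/-- The length of a path of positive definite operators. -/
def opLength {d : ℕ} (O : ℝ → Op d) : ℝ≥0∞ :=
  ∫⁻ t in Icc (0 : ℝ) 1, ENNReal.ofReal (Real.sqrt (opMetric (O t) (deriv O t) (deriv O t)))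

/-- The geodesic distance on positive definite operators, without a trace constraint. -/
def geodesicDist {d : ℕ} (A B : Op d) : ℝ≥0∞ :=
  ⨅ (O : ℝ → Op d) (_ : IsPosDefPath A B O), opLength O

/-- The operator `A ^ (-1/2)` for positive definite `A`. -/
def invSqrt {d : ℕ} (A : Op d) : Op d := cfc (fun x : ℝ => x ^ (-(1 / 2) : ℝ)) A

end

/-!
The map `P ↦ ‖log P‖_F` measures the distance to `𝟙` for the metric `tr (P⁻¹ X P⁻¹ Y)`, and all
three claims follow from this and from a way of lifting paths of states to paths of channels.

Lower bounds. For positive definite `P` the function `‖log P‖²_F = tr (log P)²` has differential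
`X ↦ 2 tr (log P · P⁻¹ X)`. This is a trace, so the derivative of the matrix logarithm never enters:
averaging the scalar Taylor estimate for `log²` over the overlaps of the eigenbases of two matrices
gives a quadratic remainder (`abs_frobNorm_log_sq_sub_le`). By Cauchy-Schwarz
(`abs_trace_cfc_mul_inv_mul_le`) the differential is at most `2 ‖log P‖_F` times the metric norm
of `X`, and integrating along a path shows that `‖log‖_F` grows by at most the length
(`ofReal_frobNorm_log_le`). Congruence by `A^{-1/2}` then bounds the geodesic distance from below,
and the explicit geodesic `A^{1/2} (A^{-1/2} B A^{-1/2})^t A^{1/2}` attains the bound.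

For a path of channels `Λₜ` the same estimate applies to `d Λₜ(𝟙/d)`, which starts at `𝟙`. The
remaining point is that a path of finite length cannot pass through a singular state, even
momentarily: as long as the state is nonsingular, the bound on `‖log‖_F` keeps its determinant
above a fixed positive constant (`logNorm_le_choiLength`).

Lifting. A smooth path of full-rank states `φₜ` from `𝟙/d` to `Λ(𝟙/d)` is the path of `Λₜ(𝟙/d)` for
`Λₜ = (1 - t) λₜ Id + t μₜ Λ + tr(·) Rₜ`, where `Rₜ` is the remainder that makes `Λₜ(𝟙/d) = φₜ`.
Since `φₜ` is Lipschitz and full-rank at both ends, piecewise linear weights `λₜ`, `μₜ` with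
`λ₀ = μ₁ = 1` can be chosen that keep `Rₜ ≥ 0` (`exists_isChannelPath`).

Upper bound. Lifting the path `(d Λ(𝟙/d))ᵗ / tr (d Λ(𝟙/d))ᵗ` gives a path of channels. With `hᵢ` the
eigenvalues of `ln d + ln Λ(𝟙/d)`, its speed is the Euclidean norm of `(hᵢ - m)ᵢ`, where `m` is a
weighted mean of the `hᵢ`, and this is at most `(√d + 1) ‖h‖` (`complexity_le`).
-/

/-! ### Spectral decompositions -/

section Spectral

/-- The Hermitian matrix `W diag(p) W†` with real weights `p`. For unitary `W` this is a spectral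
decomposition. -/
noncomputable def conjDiag {d : ℕ} (W : Op d) (p : Fin d → ℝ) : Op d :=
  W * Matrix.diagonal (fun i => (p i : ℂ)) * Wᴴ

variable {d : ℕ}

theorem Matrix.IsHermitian.exists_conjDiag {A : Op d} (hA : A.IsHermitian) :
    ∃ (U : Op d) (a : Fin d → ℝ), Uᴴ * U = 1 ∧ U * Uᴴ = 1 ∧ A = conjDiag U a ∧
      ∀ f : ℝ → ℝ, cfc f A = conjDiag U (fun i => f (a i)) := by
  refine ⟨hA.eigenvectorUnitary, hA.eigenvalues, ?_, ?_, ?_, fun f => ?_⟩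
  · exact Unitary.coe_star_mul_self hA.eigenvectorUnitary
  · exact Unitary.coe_mul_star_self hA.eigenvectorUnitary
  · conv_lhs => rw [hA.spectral_theorem, Unitary.conjStarAlgAut_apply]
    rfl
  · rw [hA.cfc_eq, Matrix.IsHermitian.cfc, Unitary.conjStarAlgAut_apply]
    rfl

theorem conjDiag_isHermitian (W : Op d) (p : Fin d → ℝ) : (conjDiag W p).IsHermitian := by
  unfold conjDiag
  apply Matrix.isHermitian_mul_mul_conjTranspose
  rw [Matrix.isHermitian_diagonal_iff]
  intro i
  simp [IsSelfAdjoint]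

theorem posSemidef_conjDiag (W : Op d) {p : Fin d → ℝ} (hp : ∀ i, 0 ≤ p i) :
    (conjDiag W p).PosSemidef := by
  apply Matrix.PosSemidef.mul_mul_conjTranspose_same
  rw [Matrix.posSemidef_diagonal_iff]
  intro i
  exact_mod_cast hp i

theorem posDef_conjDiag_iff {W : Op d} (hW : IsUnit W) {p : Fin d → ℝ} :
    (conjDiag W p).PosDef ↔ ∀ i, 0 < p i := by
  unfold conjDiag
  rw [← Matrix.star_eq_conjTranspose, Matrix.IsUnit.posDef_star_right_conjugate_iff hW,
    Matrix.posDef_diagonal_iff]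
  simp

theorem Matrix.PosDef.exists_conjDiag {A : Op d} (hA : A.PosDef) :
    ∃ (U : Op d) (a : Fin d → ℝ), Uᴴ * U = 1 ∧ U * Uᴴ = 1 ∧ (∀ i, 0 < a i) ∧
      A = conjDiag U a ∧ ∀ f : ℝ → ℝ, cfc f A = conjDiag U (fun i => f (a i)) := by
  obtain ⟨U, a, hU, hU', hAa, hf⟩ := hA.1.exists_conjDiag
  refine ⟨U, a, hU, hU', ?_, hAa, hf⟩
  rwa [hAa, posDef_conjDiag_iff (IsUnit.of_mul_eq_one _ hU')] at hA

theorem conjDiag_add (W : Op d) (p q : Fin d → ℝ) :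
    conjDiag W p + conjDiag W q = conjDiag W (fun i => p i + q i) := by
  simp only [conjDiag, ← Matrix.add_mul, ← Matrix.mul_add, Matrix.diagonal_add]
  simp

theorem conjDiag_const {U : Op d} (hU : U * Uᴴ = 1) (c : ℝ) :
    conjDiag U (fun _ => c) = (c : ℂ) • (1 : Op d) := by
  have : Matrix.diagonal (fun _ : Fin d => (c : ℂ)) = (c : ℂ) • (1 : Op d) := by
    ext i j; simp [Matrix.diagonal_apply, Matrix.one_apply]
  rw [conjDiag, this]
  simp [hU]

theorem conjDiag_mul {U : Op d} (hU : Uᴴ * U = 1) (p q : Fin d → ℝ) :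
    conjDiag U p * conjDiag U q = conjDiag U (fun i => p i * q i) := by
  unfold conjDiag
  calc _ = U * (Matrix.diagonal (fun i => (p i : ℂ)) * (Uᴴ * U) *
        Matrix.diagonal (fun i => (q i : ℂ))) * Uᴴ := by simp only [mul_assoc]
    _ = _ := by
      rw [hU, mul_one, Matrix.diagonal_mul_diagonal]
      simp

theorem trace_conjDiag {U : Op d} (hU : Uᴴ * U = 1) (p : Fin d → ℝ) :
    (conjDiag U p).trace = ((∑ i, p i : ℝ) : ℂ) := by
  rw [conjDiag, Matrix.trace_mul_comm, ← mul_assoc, hU, one_mul, Matrix.trace_diagonal]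
  simp

/-- The overlaps `|⟨uᵢ, vⱼ⟩|²` of the columns of `U` and `V` weight the products of eigenvalues. -/
theorem trace_conjDiag_mul_conjDiag (U V : Op d) (a b : Fin d → ℝ) :
    (conjDiag U a * conjDiag V b).trace =
      ((∑ i, ∑ j, Complex.normSq ((Uᴴ * V) i j) * (a i * b j) : ℝ) : ℂ) := by
  have h1 : (conjDiag U a * conjDiag V b).trace =
      ((Matrix.diagonal (fun i => (a i : ℂ)) * (Uᴴ * V)) *
        (Matrix.diagonal (fun i => (b i : ℂ)) * (Uᴴ * V)ᴴ)).trace := by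
    unfold conjDiag
    rw [mul_assoc, mul_assoc, Matrix.trace_mul_comm]
    simp only [Matrix.conjTranspose_mul, Matrix.conjTranspose_conjTranspose, mul_assoc]
  rw [h1, Matrix.trace]
  push_cast
  refine Finset.sum_congr rfl fun i _ => ?_
  rw [Matrix.diag_apply, Matrix.mul_apply]
  refine Finset.sum_congr rfl fun j _ => ?_
  rw [Matrix.diagonal_mul, Matrix.diagonal_mul, Matrix.conjTranspose_apply,
    Complex.normSq_eq_conj_mul_self]
  simp only [Complex.star_def]
  ring

theorem frobNorm_sq (X : Op d) : frobNorm X ^ 2 = (Xᴴ * X).trace.re := by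
  unfold frobNorm
  apply Real.sq_sqrt
  have := (Matrix.posSemidef_conjTranspose_mul_self X).trace_nonneg
  exact (Complex.le_def.1 this).1

theorem frobNorm_nonneg (X : Op d) : 0 ≤ frobNorm X := Real.sqrt_nonneg _

theorem frobNorm_conjDiag {U : Op d} (hU : Uᴴ * U = 1) (p : Fin d → ℝ) :
    frobNorm (conjDiag U p) = Real.sqrt (∑ i, p i ^ 2) := by
  rw [frobNorm, (conjDiag_isHermitian U p).eq, conjDiag_mul hU, trace_conjDiag hU]
  simp [pow_two]

/-- A Hermitian matrix is bounded below by minus its Frobenius norm. -/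
theorem posSemidef_add_smul_one {X : Op d} (hX : X.IsHermitian) {c : ℝ} (hc : frobNorm X ≤ c) :
    (X + (c : ℂ) • (1 : Op d)).PosSemidef := by
  obtain ⟨U, a, hU, hU', hXa, -⟩ := hX.exists_conjDiag
  rw [hXa, ← conjDiag_const hU', conjDiag_add]
  apply posSemidef_conjDiag
  intro i
  rw [hXa, frobNorm_conjDiag hU] at hc
  have : |a i| ≤ Real.sqrt (∑ i, a i ^ 2) := by
    apply Real.abs_le_sqrt
    exact Finset.single_le_sum (f := fun i => a i ^ 2) (fun _ _ => sq_nonneg _) (Finset.mem_univ i)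
  linarith [neg_abs_le (a i)]

theorem Matrix.PosDef.exists_sub_smul_one {P : Op d} (hP : P.PosDef) :
    ∃ m : ℝ, 0 < m ∧ (P - (m : ℂ) • (1 : Op d)).PosSemidef := by
  obtain ⟨U, a, hU, hU', ha, hPa, -⟩ := hP.exists_conjDiag
  obtain ⟨m, hm, hma⟩ : ∃ m : ℝ, 0 < m ∧ ∀ i, m ≤ a i := by
    obtain ⟨m, hm⟩ := (Set.finite_range (fun i => (a i)⁻¹)).bddAbove
    refine ⟨(max m 1)⁻¹, by positivity, fun i => ?_⟩
    rw [inv_le_comm₀ (by positivity) (ha i)]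
    exact (hm ⟨i, rfl⟩).trans (le_max_left _ _)
  refine ⟨m, hm, ?_⟩
  have : P - (m : ℂ) • (1 : Op d) = conjDiag U (fun i => a i + -m) := by
    rw [← conjDiag_add, ← hPa, conjDiag_const hU']
    simp [sub_eq_add_neg]
  rw [this]
  exact posSemidef_conjDiag _ fun i => by linarith [hma i]

theorem inv_conjDiag {U : Op d} (hU : Uᴴ * U = 1) (hU' : U * Uᴴ = 1) {p : Fin d → ℝ}
    (hp : ∀ i, p i ≠ 0) : (conjDiag U p)⁻¹ = conjDiag U (fun i => (p i)⁻¹) := by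
  apply Matrix.inv_eq_right_inv
  rw [conjDiag_mul hU]
  simp only [mul_inv_cancel₀ (hp _)]
  simpa using conjDiag_const hU' 1

end Spectral

/-! ### The metric -/

section Metric

variable {d : ℕ}

/-- The metric is invariant under congruence. -/
theorem opMetric_congr {W : Op d} (hW : IsUnit W) (P X Y : Op d) :
    opMetric (W * P * Wᴴ) (W * X * Wᴴ) (W * Y * Wᴴ) = opMetric P X Y := by
  have h1 : W⁻¹ * W = 1 := Matrix.nonsing_inv_mul _ ((Matrix.isUnit_iff_isUnit_det _).1 hW)
  have hW' : IsUnit Wᴴ := by simpa [← Matrix.star_eq_conjTranspose] using hW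
  have h2 : Wᴴ * (Wᴴ)⁻¹ = 1 := Matrix.mul_nonsing_inv _ ((Matrix.isUnit_iff_isUnit_det _).1 hW')
  unfold opMetric
  rw [Matrix.mul_inv_rev, Matrix.mul_inv_rev]
  have : (Wᴴ)⁻¹ * (P⁻¹ * W⁻¹) * (W * X * Wᴴ) * ((Wᴴ)⁻¹ * (P⁻¹ * W⁻¹)) * (W * Y * Wᴴ) =
      (Wᴴ)⁻¹ * (P⁻¹ * X * P⁻¹ * Y * Wᴴ) := by
    calc _ = (Wᴴ)⁻¹ * (P⁻¹ * (W⁻¹ * W) * X * (Wᴴ * (Wᴴ)⁻¹) * P⁻¹ * (W⁻¹ * W) * Y * Wᴴ) := by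
          simp only [mul_assoc]
      _ = _ := by rw [h1, h2]; simp only [mul_one]
  rw [this, Matrix.trace_mul_comm, mul_assoc, h2, mul_one]

theorem opMetric_conjDiag {W : Op d} (hW : IsUnit W) {p : Fin d → ℝ} (hp : ∀ i, p i ≠ 0)
    (q : Fin d → ℝ) :
    opMetric (conjDiag W p) (conjDiag W q) (conjDiag W q) = ∑ i, (q i / p i) ^ 2 := by
  unfold conjDiag
  rw [opMetric_congr hW, opMetric]
  have : (Matrix.diagonal fun i => (p i : ℂ))⁻¹ = Matrix.diagonal fun i => ((p i)⁻¹ : ℂ) := by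
    apply Matrix.inv_eq_right_inv
    rw [Matrix.diagonal_mul_diagonal]
    simp [hp]
  rw [this]
  simp only [Matrix.diagonal_mul_diagonal, Matrix.trace_diagonal]
  rw [Complex.re_sum]
  refine Finset.sum_congr rfl fun i _ => ?_
  norm_cast
  field_simp [hp i]

theorem opMetric_smul {c : ℂ} (hc : c ≠ 0) (P X Y : Op d) :
    opMetric (c • P) (c • X) (c • Y) = opMetric P X Y := by
  unfold opMetric
  have : (c • P)⁻¹ = c⁻¹ • P⁻¹ := by
    by_cases hP : IsUnit P.det
    · apply Matrix.inv_eq_right_inv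
      simp [Matrix.mul_nonsing_inv _ hP, smul_smul, hc]
    · rw [Matrix.nonsing_inv_apply_not_isUnit _ hP, Matrix.nonsing_inv_apply_not_isUnit]
      · simp
      · rw [Matrix.det_smul]
        simpa [hc] using hP
  rw [this]
  congr 1
  simp only [Matrix.smul_mul, Matrix.mul_smul, smul_smul]
  simp [hc]

/-- Cauchy-Schwarz for the metric at `P`: the covector `X ↦ tr (f(P) P⁻¹ X)` has norm at most
`‖f(P)‖_F`. In an eigenbasis of `P` only the diagonal of `X` enters the left-hand side. -/
theorem abs_trace_cfc_mul_inv_mul_le {P X : Op d} (hP : P.PosDef) (hX : X.IsHermitian)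
    (f : ℝ → ℝ) :
    |(cfc f P * P⁻¹ * X).trace.re| ≤ frobNorm (cfc f P) * Real.sqrt (opMetric P X X) := by
  obtain ⟨U, a, hU, hU', ha, hPa, hf⟩ := hP.exists_conjDiag
  have hUu : IsUnit U := IsUnit.of_mul_eq_one _ hU'
  set Y : Op d := Uᴴ * X * U with hY
  have hYh : Y.IsHermitian := Matrix.isHermitian_conjTranspose_mul_mul U hX
  have hXY : X = U * Y * Uᴴ := by
    calc X = (U * Uᴴ) * X * (U * Uᴴ) := by rw [hU', one_mul, mul_one]
      _ = _ := by simp only [hY, mul_assoc]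
  have h1 : (cfc f P * P⁻¹ * X).trace.re = ∑ i, f (a i) * ((Y i i).re / a i) := by
    have : cfc f P * P⁻¹ = conjDiag U (fun i => f (a i) * (a i)⁻¹) := by
      rw [hf f, hPa, inv_conjDiag hU hU' (fun i => (ha i).ne'), conjDiag_mul hU]
    rw [this, conjDiag, mul_assoc, mul_assoc, Matrix.trace_mul_comm, mul_assoc,
      show Uᴴ * X * U = Y from rfl, Matrix.trace, Complex.re_sum]
    refine Finset.sum_congr rfl fun i _ => ?_
    rw [Matrix.diag_apply, Matrix.diagonal_mul, Complex.re_ofReal_mul]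
    ring
  have h2 : opMetric P X X = ∑ i, ∑ j, Complex.normSq (Y i j) / (a i * a j) := by
    rw [hPa, hXY, conjDiag, opMetric_congr hUu, opMetric]
    have : (Matrix.diagonal fun i => (a i : ℂ))⁻¹ = Matrix.diagonal fun i => ((a i)⁻¹ : ℂ) := by
      apply Matrix.inv_eq_right_inv
      rw [Matrix.diagonal_mul_diagonal]
      simp [fun i => (ha i).ne']
    rw [this, mul_assoc, Matrix.trace, Complex.re_sum]
    refine Finset.sum_congr rfl fun i _ => ?_
    rw [Matrix.diag_apply, Matrix.mul_apply, Complex.re_sum]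
    refine Finset.sum_congr rfl fun j _ => ?_
    rw [Matrix.diagonal_mul, Matrix.diagonal_mul, ← hYh.apply i j, Complex.star_def]
    have : (((a i : ℂ))⁻¹ * (starRingEnd ℂ) (Y j i) * (((a j : ℂ))⁻¹ * Y j i)) =
        (((a i)⁻¹ * (a j)⁻¹ * Complex.normSq (Y j i) : ℝ) : ℂ) := by
      push_cast
      rw [Complex.normSq_eq_conj_mul_self]
      ring
    rw [this, Complex.ofReal_re, Complex.normSq_conj]
    field_simp
  have h3 : ∑ i, ((Y i i).re / a i) ^ 2 ≤ opMetric P X X := by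
    rw [h2]
    refine Finset.sum_le_sum fun i _ => ?_
    refine le_trans ?_ (Finset.single_le_sum
      (f := fun j => Complex.normSq (Y i j) / (a i * a j)) (fun j _ => ?_) (Finset.mem_univ i))
    · rw [div_pow, ← pow_two]
      gcongr
      rw [Complex.normSq_apply]
      nlinarith [sq_nonneg (Y i i).im]
    · exact div_nonneg (Complex.normSq_nonneg _) (mul_pos (ha i) (ha j)).le
  rw [h1, hf f, frobNorm_conjDiag hU]
  calc _ ≤ Real.sqrt ((∑ i, f (a i) ^ 2) * ∑ i, ((Y i i).re / a i) ^ 2) :=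
        Real.abs_le_sqrt (Finset.sum_mul_sq_le_sq_mul_sq _ _ _)
    _ = Real.sqrt (∑ i, f (a i) ^ 2) * Real.sqrt (∑ i, ((Y i i).re / a i) ^ 2) :=
        Real.sqrt_mul (Finset.sum_nonneg fun _ _ => sq_nonneg _) _
    _ ≤ _ := by gcongr

end Metric

/-! ### Entrywise calculus -/

section MatrixCalculus

variable {ι : Type}

/-- Matrices carry a topology but no canonical norm, so facts about derivatives that Mathlib states
for normed spaces are obtained from the product structure here and in the next lemmas. -/
theorem hasDerivAt_matrix_iff [Finite ι] {M : ℝ → Matrix ι ι ℂ} {M' : Matrix ι ι ℂ} {t : ℝ} :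
    HasDerivAt M M' t ↔ ∀ i j, HasDerivAt (fun s => M s i j) (M' i j) t := by
  have := Fintype.ofFinite ι
  have h : HasDerivAt M M' t ↔ ∀ i, HasDerivAt (F := ι → ℂ) (fun s => M s i) (M' i) t :=
    hasDerivAt_pi (E' := fun _ : ι => ι → ℂ) (φ := fun s => M s) (φ' := M')
  exact h.trans (forall_congr' fun i => hasDerivAt_pi)

theorem Matrix.hasDerivAt_of_differentiableAt [Finite ι] {M : ℝ → Matrix ι ι ℂ} {t : ℝ}
    (h : DifferentiableAt ℝ M t) : HasDerivAt M (deriv M t) t := by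
  have := Fintype.ofFinite ι
  exact DifferentiableAt.hasDerivAt (F := ι → ι → ℂ) h

theorem Matrix.differentiableAt_of_hasDerivAt [Finite ι] {M : ℝ → Matrix ι ι ℂ}
    {M' : Matrix ι ι ℂ} {t : ℝ} (h : HasDerivAt M M' t) : DifferentiableAt ℝ M t := by
  have := Fintype.ofFinite ι
  exact HasDerivAt.differentiableAt (F := ι → ι → ℂ) h

theorem Matrix.deriv_eq_of_hasDerivAt [Finite ι] {M : ℝ → Matrix ι ι ℂ} {M' : Matrix ι ι ℂ} {t : ℝ}
    (h : HasDerivAt M M' t) : deriv M t = M' := by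
  have := Fintype.ofFinite ι
  exact HasDerivAt.deriv (F := ι → ι → ℂ) h

theorem continuousOn_matrix_iff {M : ℝ → Matrix ι ι ℂ} {s : Set ℝ} :
    ContinuousOn M s ↔ ∀ i j, ContinuousOn (fun t => M t i j) s := by
  have h : ContinuousOn M s ↔ ∀ i, ContinuousOn (Y := ι → ℂ) (fun t => M t i) s :=
    continuousOn_pi (X := fun _ : ι => ι → ℂ) (f := fun s => M s)
  exact h.trans (forall_congr' fun i => continuousOn_pi)

end MatrixCalculus

/-! ### First-order expansion of `tr (log P)²` -/

section TraceTaylor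

variable {d : ℕ}

/-- Second-order Taylor estimate for `log²`, uniform on `[κ⁻¹, κ]`. -/
theorem abs_log_sq_sub_le {κ x y : ℝ} (hκ : 0 < κ) (hx : κ⁻¹ ≤ x) (hx' : x ≤ κ)
    (hy : κ⁻¹ ≤ y) :
    |Real.log y ^ 2 - Real.log x ^ 2 - 2 * (Real.log x / x * (y - x))| ≤
      κ ^ 2 * (1 + 2 * κ) * (y - x) ^ 2 := by
  have hκ' : 0 < κ⁻¹ := by positivity
  have hx0 : 0 < x := hκ'.trans_le hx
  have hy0 : 0 < y := hκ'.trans_le hy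
  have hxi : x⁻¹ ≤ κ := inv_le_of_inv_le₀ hκ hx
  have hyi : y⁻¹ ≤ κ := inv_le_of_inv_le₀ hκ hy
  have hxi0 : 0 < x⁻¹ := by positivity
  have hyi0 : 0 < y⁻¹ := by positivity
  set u := Real.log y - Real.log x with hu
  have huy : u = Real.log (y / x) := by rw [Real.log_div hy0.ne' hx0.ne']
  have hu1 : u ≤ (y - x) * x⁻¹ := by
    have := Real.log_le_sub_one_of_pos (div_pos hy0 hx0)
    rw [huy]
    refine this.trans (le_of_eq ?_)
    field_simp
  have hu2 : (y - x) * y⁻¹ ≤ u := by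
    have := Real.one_sub_inv_le_log_of_pos (div_pos hy0 hx0)
    rw [huy]
    refine le_trans (le_of_eq ?_) this
    field_simp
  have hul : |u| ≤ κ * |y - x| := by
    rw [abs_le]
    have h1 := le_abs_self (y - x)
    have h2 := neg_abs_le (y - x)
    have h0 := abs_nonneg (y - x)
    constructor
    · nlinarith
    · nlinarith
  have hu3 : |(y - x) * x⁻¹ - u| ≤ κ ^ 2 * (y - x) ^ 2 := by
    rw [abs_of_nonneg (by linarith)]
    have : (y - x) * x⁻¹ - (y - x) * y⁻¹ = (x⁻¹ * y⁻¹) * (y - x) ^ 2 := by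
      field_simp
    have h4 : x⁻¹ * y⁻¹ ≤ κ ^ 2 := by
      rw [pow_two]; exact mul_le_mul hxi hyi hyi0.le hκ.le
    have : (x⁻¹ * y⁻¹) * (y - x) ^ 2 ≤ κ ^ 2 * (y - x) ^ 2 := by gcongr
    linarith
  have hlx : |Real.log x| ≤ κ := by
    rw [abs_le]
    have h1 := Real.log_le_sub_one_of_pos hx0
    have h2 := Real.log_le_sub_one_of_pos hxi0
    rw [Real.log_inv] at h2
    constructor <;> linarith
  have hexp : Real.log y ^ 2 - Real.log x ^ 2 - 2 * (Real.log x / x * (y - x)) =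
      u ^ 2 - 2 * (Real.log x * ((y - x) * x⁻¹ - u)) := by
    rw [hu]; field_simp; ring
  rw [hexp]
  calc _ ≤ |u ^ 2| + |2 * (Real.log x * ((y - x) * x⁻¹ - u))| := abs_sub _ _
    _ = |u| ^ 2 + 2 * (|Real.log x| * |(y - x) * x⁻¹ - u|) := by
      rw [abs_pow, abs_mul, abs_mul, abs_two]
    _ ≤ (κ * |y - x|) ^ 2 + 2 * (κ * (κ ^ 2 * (y - x) ^ 2)) := by gcongr
    _ = _ := by rw [mul_pow, sq_abs]; ring

theorem le_trace_conjDiag {U : Op d} (hU : Uᴴ * U = 1) {p : Fin d → ℝ} (hp : ∀ i, 0 ≤ p i)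
    (i : Fin d) : p i ≤ (conjDiag U p).trace.re := by
  rw [trace_conjDiag hU, Complex.ofReal_re]
  exact Finset.single_le_sum (f := p) (fun i _ => hp i) (Finset.mem_univ i)

/-- The function `P ↦ ‖log P‖²_F` on positive definite matrices has differential
`X ↦ 2 tr (log P · P⁻¹ X)`, with a quadratic remainder that is uniform where `P` and `P⁻¹` are
bounded. The scalar Taylor estimate is averaged over the overlaps of the two eigenbases; the
differential of the matrix logarithm is not needed. -/
theorem abs_frobNorm_log_sq_sub_le {A B : Op d} (hA : A.PosDef) (hB : B.PosDef) {κ : ℝ}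
    (hκ : 0 < κ) (hA1 : A.trace.re ≤ κ) (hA2 : A⁻¹.trace.re ≤ κ) (hB2 : B⁻¹.trace.re ≤ κ) :
    |frobNorm (cfc Real.log B) ^ 2 - frobNorm (cfc Real.log A) ^ 2 -
        2 * (cfc Real.log A * A⁻¹ * (B - A)).trace.re| ≤
      κ ^ 2 * (1 + 2 * κ) * frobNorm (B - A) ^ 2 := by
  obtain ⟨U, a, hU, hU', ha, hAa, hfA⟩ := hA.exists_conjDiag
  obtain ⟨V, b, hV, hV', hb, hBb, hfB⟩ := hB.exists_conjDiag
  -- By orthonormality `w` has row and column sums `1`, so single traces are sums over `w` as well.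
  set w : Fin d → Fin d → ℝ := fun i j => Complex.normSq ((Uᴴ * V) i j) with hw
  have hw0 : ∀ i j, 0 ≤ w i j := fun i j => Complex.normSq_nonneg _
  have key : ∀ f g : Fin d → ℝ, (conjDiag U f * conjDiag V g).trace.re =
      ∑ i, ∑ j, w i j * (f i * g j) := fun f g => by
    rw [trace_conjDiag_mul_conjDiag, Complex.ofReal_re]
  have oneU : conjDiag U (fun _ => 1) = 1 := by simpa using conjDiag_const hU' 1
  have oneV : conjDiag V (fun _ => 1) = 1 := by simpa using conjDiag_const hV' 1
  have trU : ∀ f : Fin d → ℝ, (conjDiag U f).trace.re = ∑ i, ∑ j, w i j * f i := fun f => by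
    have := key f (fun _ => 1)
    rw [oneV, mul_one] at this
    simpa using this
  have trV : ∀ f : Fin d → ℝ, (conjDiag V f).trace.re = ∑ i, ∑ j, w i j * f j := fun f => by
    have := key (fun _ => 1) f
    rw [oneU, one_mul] at this
    simpa using this
  have e1 : frobNorm (cfc Real.log B) ^ 2 = ∑ i, ∑ j, w i j * Real.log (b j) ^ 2 := by
    rw [frobNorm_sq, hfB, (conjDiag_isHermitian _ _).eq, conjDiag_mul hV, trV]
    simp only [pow_two]
  have e2 : frobNorm (cfc Real.log A) ^ 2 = ∑ i, ∑ j, w i j * Real.log (a i) ^ 2 := by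
    rw [frobNorm_sq, hfA, (conjDiag_isHermitian _ _).eq, conjDiag_mul hU, trU]
    simp only [pow_two]
  have e3 : (cfc Real.log A * A⁻¹ * (B - A)).trace.re =
      ∑ i, ∑ j, w i j * (Real.log (a i) / a i * (b j - a i)) := by
    rw [hfA, mul_sub, Matrix.trace_sub, Complex.sub_re]
    conv_lhs => rw [hAa, hBb]
    rw [inv_conjDiag hU hU' (fun i => (ha i).ne'), conjDiag_mul hU, key, conjDiag_mul hU, trU]
    simp only [← Finset.sum_sub_distrib]
    refine Finset.sum_congr rfl fun i _ => Finset.sum_congr rfl fun j _ => ?_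
    ring
  have e4 : frobNorm (B - A) ^ 2 = ∑ i, ∑ j, w i j * (b j - a i) ^ 2 := by
    have : ((B - A) * (B - A)).trace.re =
        (B * B).trace.re - 2 * (A * B).trace.re + (A * A).trace.re := by
      have h : (B - A) * (B - A) = B * B - B * A - A * B + A * A := by noncomm_ring
      rw [h, Matrix.trace_add, Matrix.trace_sub, Matrix.trace_sub, Matrix.trace_mul_comm B A,
        Complex.add_re, Complex.sub_re, Complex.sub_re]
      ring
    rw [frobNorm_sq, (hB.1.sub hA.1).eq, this, hAa, hBb, key, conjDiag_mul hU, conjDiag_mul hV,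
      trU, trV, Finset.mul_sum, ← Finset.sum_sub_distrib, ← Finset.sum_add_distrib]
    refine Finset.sum_congr rfl fun i _ => ?_
    rw [Finset.mul_sum, ← Finset.sum_sub_distrib, ← Finset.sum_add_distrib]
    refine Finset.sum_congr rfl fun j _ => ?_
    ring
  rw [e1, e2, e3, e4, Finset.mul_sum, ← Finset.sum_sub_distrib, ← Finset.sum_sub_distrib,
    Finset.mul_sum]
  refine (Finset.abs_sum_le_sum_abs _ _).trans (Finset.sum_le_sum fun i _ => ?_)
  rw [Finset.mul_sum, ← Finset.sum_sub_distrib, ← Finset.sum_sub_distrib, Finset.mul_sum]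
  refine (Finset.abs_sum_le_sum_abs _ _).trans (Finset.sum_le_sum fun j _ => ?_)
  have ha1 : κ⁻¹ ≤ a i := by
    rw [hAa, inv_conjDiag hU hU' (fun i => (ha i).ne')] at hA2
    exact inv_le_of_inv_le₀ (ha i)
      ((le_trace_conjDiag hU (fun i => (inv_pos.2 (ha i)).le) i).trans hA2)
  have hb1 : κ⁻¹ ≤ b j := by
    rw [hBb, inv_conjDiag hV hV' (fun i => (hb i).ne')] at hB2
    exact inv_le_of_inv_le₀ (hb j)
      ((le_trace_conjDiag hV (fun i => (inv_pos.2 (hb i)).le) j).trans hB2)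
  have ha2 : a i ≤ κ := by
    rw [hAa] at hA1
    exact (le_trace_conjDiag hU (fun i => (ha i).le) i).trans hA1
  have := abs_log_sq_sub_le hκ ha1 ha2 hb1
  calc _ = w i j * |Real.log (b j) ^ 2 - Real.log (a i) ^ 2 -
        2 * (Real.log (a i) / a i * (b j - a i))| := by
        rw [← abs_of_nonneg (hw0 i j), ← abs_mul, abs_of_nonneg (hw0 i j)]
        congr 1
        ring
    _ ≤ w i j * (κ ^ 2 * (1 + 2 * κ) * (b j - a i) ^ 2) := by gcongr; exact hw0 i j
    _ = _ := by ring

end TraceTaylor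

/-! ### `‖log‖_F` is bounded by the length -/

section LengthBound

/-- If `F ≥ 0` is continuous on `[0, T]` and `|F'| ≤ 2 √F v` off a countable set, then `√F`
increases by at most `∫ v`. -/
theorem ofReal_sqrt_le_add_lintegral {F F' v : ℝ → ℝ} {T : ℝ} (hT : 0 ≤ T) (hF : ∀ t, 0 ≤ F t)
    (hv : ∀ t, 0 ≤ v t) (hc : ContinuousOn F (Icc 0 T)) {S : Set ℝ} (hS : S.Countable)
    (hd : ∀ t ∈ Ioo 0 T \ S, HasDerivAt F (F' t) t)
    (hle : ∀ t ∈ Ioo 0 T \ S, |F' t| ≤ 2 * (Real.sqrt (F t) * v t)) :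
    ENNReal.ofReal (Real.sqrt (F T)) ≤
      ENNReal.ofReal (Real.sqrt (F 0)) + ∫⁻ t in Icc 0 T, ENNReal.ofReal (v t) := by
  rcases eq_or_ne (∫⁻ t in Icc 0 T, ENNReal.ofReal (v t)) ⊤ with htop | hfin
  · simp [htop]
  set L := (∫⁻ t in Icc 0 T, ENNReal.ofReal (v t)).toReal with hL
  rw [← ENNReal.ofReal_toReal hfin, ← hL, ← ENNReal.ofReal_add (Real.sqrt_nonneg _)
    ENNReal.toReal_nonneg]
  apply ENNReal.ofReal_le_ofReal
  refine le_of_forall_pos_le_add fun η hη => ?_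
  -- `√F` need not be differentiable at zeros of `F`, but `√(F + η²)` is.
  set G : ℝ → ℝ := fun t => Real.sqrt (F t + η ^ 2) with hG
  have hpos : ∀ t, 0 < F t + η ^ 2 := fun t => by have := hF t; positivity
  have hGc : ContinuousOn G (Icc 0 T) := (hc.add continuousOn_const).sqrt
  have hGd : ∀ t ∈ Ioo 0 T \ S, HasDerivAt G (deriv G t) t := fun t ht =>
    (((hd t ht).add_const (η ^ 2)).sqrt (hpos t).ne').differentiableAt.hasDerivAt
  have hGle : ∀ t ∈ Ioo 0 T \ S, |deriv G t| ≤ v t := by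
    intro t ht
    rw [(((hd t ht).add_const (η ^ 2)).sqrt (hpos t).ne').deriv, abs_div,
      abs_of_pos (by have := Real.sqrt_pos.2 (hpos t); positivity :
        0 < 2 * Real.sqrt (F t + η ^ 2)),
      div_le_iff₀ (by have := Real.sqrt_pos.2 (hpos t); positivity)]
    have h1 := hle t ht
    have h2 : Real.sqrt (F t) * v t ≤ Real.sqrt (F t + η ^ 2) * v t :=
      mul_le_mul_of_nonneg_right (Real.sqrt_le_sqrt (by nlinarith)) (hv t)
    linarith
  have hae : ∀ᵐ t ∂(volume.restrict (Icc 0 T)), ‖deriv G t‖ₑ ≤ ENNReal.ofReal (v t) := by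
    rw [ae_restrict_iff' measurableSet_Icc]
    have h0 : ∀ᵐ t : ℝ, t ∉ S ∪ {0, T} := by
      apply measure_eq_zero_iff_ae_notMem.1
      exact (hS.union ((Set.toFinite {0, T}).countable)).measure_zero _
    filter_upwards [h0] with t ht htI
    simp only [mem_union, mem_insert_iff, mem_singleton_iff, not_or] at ht
    have := hGle t ⟨⟨lt_of_le_of_ne htI.1 (Ne.symm ht.2.1), lt_of_le_of_ne htI.2 ht.2.2⟩, ht.1⟩
    rw [← ofReal_norm, Real.norm_eq_abs]
    exact ENNReal.ofReal_le_ofReal this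
  have hlin : ∫⁻ t in Icc 0 T, ‖deriv G t‖ₑ ≤ ∫⁻ t in Icc 0 T, ENNReal.ofReal (v t) :=
    lintegral_mono_ae hae
  have hint : IntegrableOn (deriv G) (Icc 0 T) :=
    ⟨(measurable_deriv G).aestronglyMeasurable, hlin.trans_lt hfin.lt_top⟩
  have hftc : ∫ t in (0 : ℝ)..T, deriv G t = G T - G 0 := by
    refine integral_eq_of_hasDerivAt_off_countable_of_le G (deriv G) hT hS hGc hGd ?_
    rw [intervalIntegrable_iff_integrableOn_Icc_of_le hT]
    exact hint
  have hGL : G T - G 0 ≤ L := by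
    rw [← hftc, intervalIntegral.integral_of_le hT, ← integral_Icc_eq_integral_Ioc]
    refine (le_abs_self _).trans ?_
    rw [← Real.norm_eq_abs]
    refine (norm_integral_le_lintegral_norm _).trans ?_
    refine ENNReal.toReal_mono hfin ?_
    simpa only [ofReal_norm] using hlin
  have h1 : Real.sqrt (F T) ≤ G T := Real.sqrt_le_sqrt (by nlinarith)
  have h2 : G 0 ≤ Real.sqrt (F 0) + η := by
    rw [hG, Real.sqrt_le_iff]
    have := Real.sq_sqrt (hF 0)
    have := Real.sqrt_nonneg (F 0)
    exact ⟨by positivity, by nlinarith⟩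
  linarith

variable {d : ℕ}

theorem frobNorm_sq_eq_sum (X : Op d) : frobNorm X ^ 2 = ∑ i, ∑ j, ‖X i j‖ ^ 2 := by
  rw [frobNorm_sq, Matrix.trace, Complex.re_sum, Finset.sum_comm]
  refine Finset.sum_congr rfl fun i _ => ?_
  rw [Matrix.diag_apply, Matrix.mul_apply, Complex.re_sum]
  refine Finset.sum_congr rfl fun j _ => ?_
  rw [Matrix.conjTranspose_apply, Complex.star_def, ← Complex.normSq_eq_conj_mul_self,
    Complex.ofReal_re, Complex.normSq_eq_norm_sq]

theorem hasDerivAt_re_trace_mul {O : ℝ → Op d} {O' : Op d} {t : ℝ} (h : HasDerivAt O O' t)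
    (K : Op d) : HasDerivAt (fun s => (K * O s).trace.re) (K * O').trace.re t := by
  rw [hasDerivAt_matrix_iff] at h
  have : HasDerivAt (fun s => (K * O s).trace) (K * O').trace t := by
    simp only [Matrix.trace, Matrix.diag_apply, Matrix.mul_apply]
    exact HasDerivAt.fun_sum fun i _ => HasDerivAt.fun_sum fun j _ => (h j i).const_mul _
  exact Complex.reCLM.hasFDerivAt.comp_hasDerivAt t this

theorem hasDerivAt_frobNorm_sub_sq {O : ℝ → Op d} {O' : Op d} {t : ℝ} (h : HasDerivAt O O' t) :
    HasDerivAt (fun s => frobNorm (O s - O t) ^ 2) 0 t := by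
  rw [hasDerivAt_matrix_iff] at h
  simp only [frobNorm_sq_eq_sum, Matrix.sub_apply]
  have : HasDerivAt (fun s => ∑ i, ∑ j, ‖O s i j - O t i j‖ ^ 2)
      (∑ i, ∑ j, 2 * inner ℝ (O t i j - O t i j) (O' i j)) t :=
    HasDerivAt.fun_sum fun i _ => HasDerivAt.fun_sum fun j _ => ((h i j).sub_const _).norm_sq
  simpa using this

theorem isHermitian_of_hasDerivAt {O : ℝ → Op d} {O' : Op d} {t : ℝ} (h : HasDerivAt O O' t)
    (hO : ∀ᶠ s in nhds t, (O s).IsHermitian) : O'.IsHermitian := by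
  rw [hasDerivAt_matrix_iff] at h
  refine Matrix.IsHermitian.ext fun i j => ?_
  have h1 : HasDerivAt (fun s => star (O s j i)) (star (O' j i)) t := (h j i).star
  refine (h1.congr_of_eventuallyEq ?_).unique (h i j)
  filter_upwards [hO] with s hs
  exact (hs.apply i j).symm

/-- A function that is quadratically close to one with a derivative has the same derivative. -/
theorem HasDerivAt.of_abs_sub_le {f g N : ℝ → ℝ} {g' C t : ℝ} (hg : HasDerivAt g g' t)
    (hN : HasDerivAt N 0 t) (hNt : N t = 0)
    (hle : ∀ᶠ s in nhds t, |f s - f t - (g s - g t)| ≤ C * N s) : HasDerivAt f g' t := by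
  have h0 : HasDerivAt (fun s => f s - f t - (g s - g t)) 0 t := by
    rw [hasDerivAt_iff_isLittleO] at hN ⊢
    simp only [smul_zero, sub_zero, hNt, sub_self] at hN ⊢
    refine Asymptotics.IsBigO.trans_isLittleO (Asymptotics.IsBigO.of_bound |C| ?_) hN
    filter_upwards [hle] with s hs
    rw [Real.norm_eq_abs, Real.norm_eq_abs, ← abs_mul]
    exact hs.trans (le_abs_self _)
  have := (h0.add (hg.sub_const (g t))).add_const (f t)
  rw [zero_add] at this
  refine this.congr_of_eventuallyEq (Filter.Eventually.of_forall fun s => ?_)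
  simp

/-- Along a path of positive definite matrices, `‖log O‖_F` grows by at most the length. -/
theorem ofReal_frobNorm_log_le {O : ℝ → Op d} {T : ℝ} (hT : 0 ≤ T)
    (hpd : ∀ t ∈ Icc 0 T, (O t).PosDef) (hc : ContinuousOn O (Icc 0 T)) {S : Set ℝ}
    (hS : S.Countable) (hd : ∀ t ∈ Ioo 0 T \ S, DifferentiableAt ℝ O t) :
    ENNReal.ofReal (frobNorm (cfc Real.log (O T))) ≤
      ENNReal.ofReal (frobNorm (cfc Real.log (O 0))) + ∫⁻ t in Icc 0 T,
        ENNReal.ofReal (Real.sqrt (opMetric (O t) (deriv O t) (deriv O t))) := by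
  have hci : ContinuousOn (fun t => (O t)⁻¹) (Icc 0 T) := by
    intro t ht
    refine ContinuousAt.comp_continuousWithinAt (g := fun A : Op d => A⁻¹) ?_ (hc t ht)
    apply continuousAt_matrix_inv
    rw [Ring.inverse_eq_inv']
    apply continuousAt_inv₀
    exact ((Matrix.isUnit_iff_isUnit_det _).1 (hpd t ht).isUnit).ne_zero
  have htr : Continuous fun A : Op d => A.trace.re :=
    Complex.continuous_re.comp continuous_id.matrix_trace
  obtain ⟨κ₁, hκ₁⟩ := isCompact_Icc.exists_bound_of_continuousOn (htr.comp_continuousOn hc)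
  obtain ⟨κ₂, hκ₂⟩ := isCompact_Icc.exists_bound_of_continuousOn (htr.comp_continuousOn hci)
  -- By compactness the spectra of all `O t` lie in one interval `[κ⁻¹, κ]`.
  set κ := max (max κ₁ κ₂) 1 with hκ
  have hκ0 : 0 < κ := lt_of_lt_of_le one_pos (le_max_right _ _)
  have b1 : ∀ t ∈ Icc 0 T, (O t).trace.re ≤ κ := fun t ht =>
    (le_abs_self _).trans ((hκ₁ t ht).trans ((le_max_left _ _).trans (le_max_left _ _)))
  have b2 : ∀ t ∈ Icc 0 T, (O t)⁻¹.trace.re ≤ κ := fun t ht =>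
    (le_abs_self _).trans ((hκ₂ t ht).trans ((le_max_right _ _).trans (le_max_left _ _)))
  set F : ℝ → ℝ := fun t => frobNorm (cfc Real.log (O t)) ^ 2 with hF
  set C := κ ^ 2 * (1 + 2 * κ) with hC
  have htaylor : ∀ t ∈ Icc 0 T, ∀ s ∈ Icc 0 T,
      |F s - F t - ((2 * (cfc Real.log (O t) * (O t)⁻¹ * O s).trace.re) -
        (2 * (cfc Real.log (O t) * (O t)⁻¹ * O t).trace.re))| ≤ C * frobNorm (O s - O t) ^ 2 := by
    intro t ht s hs
    have := abs_frobNorm_log_sq_sub_le (hpd t ht) (hpd s hs) hκ0 (b1 t ht) (b2 t ht) (b2 s hs)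
    rwa [mul_sub, Matrix.trace_sub, Complex.sub_re, mul_sub 2] at this
  have hderiv : ∀ t ∈ Ioo 0 T \ S, HasDerivAt F
      (2 * (cfc Real.log (O t) * (O t)⁻¹ * deriv O t).trace.re) t := by
    intro t ht
    have hO := Matrix.hasDerivAt_of_differentiableAt (hd t ht)
    refine ((hasDerivAt_re_trace_mul hO _).const_mul 2).of_abs_sub_le (C := C)
      (hasDerivAt_frobNorm_sub_sq hO) (by simp [frobNorm]) ?_
    filter_upwards [Icc_mem_nhds ht.1.1 ht.1.2] with s hs
    exact htaylor t (Ioo_subset_Icc_self ht.1) s hs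
  have hcont : ContinuousOn F (Icc 0 T) := by
    intro t ht
    have hN : ContinuousOn (fun s => C * frobNorm (O s - O t) ^ 2) (Icc 0 T) := by
      simp only [frobNorm_sq_eq_sum, Matrix.sub_apply]
      have := continuousOn_matrix_iff.1 hc
      fun_prop
    have hg : ContinuousOn (fun s => 2 * (cfc Real.log (O t) * (O t)⁻¹ * O s).trace.re)
        (Icc 0 T) :=
      continuousOn_const.mul (htr.comp_continuousOn (continuousOn_const.mul hc))
    have h1 : Filter.Tendsto (fun s => F s - F t -
        ((2 * (cfc Real.log (O t) * (O t)⁻¹ * O s).trace.re) -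
        (2 * (cfc Real.log (O t) * (O t)⁻¹ * O t).trace.re))) (nhdsWithin t (Icc 0 T))
        (nhds 0) := by
      refine squeeze_zero_norm' ?_ (a := fun s => C * frobNorm (O s - O t) ^ 2) ?_
      · filter_upwards [self_mem_nhdsWithin] with s hs
        exact htaylor t ht s hs
      · have := hN t ht
        simpa [ContinuousWithinAt, frobNorm] using this
    have h2 := (h1.add ((hg t ht).sub_const
      (2 * (cfc Real.log (O t) * (O t)⁻¹ * O t).trace.re))).add_const (F t)
    simpa [ContinuousWithinAt] using h2
  have := ofReal_sqrt_le_add_lintegral (F := F) hT (fun t => sq_nonneg _)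
    (fun t => Real.sqrt_nonneg (opMetric (O t) (deriv O t) (deriv O t))) hcont hS hderiv ?_
  · simpa only [hF, Real.sqrt_sq (frobNorm_nonneg _)] using this
  intro t ht
  rw [abs_mul, abs_two, hF, Real.sqrt_sq (frobNorm_nonneg _)]
  gcongr
  refine abs_trace_cfc_mul_inv_mul_le (hpd t (Ioo_subset_Icc_self ht.1)) ?_ _
  refine isHermitian_of_hasDerivAt (Matrix.hasDerivAt_of_differentiableAt (hd t ht)) ?_
  filter_upwards [Icc_mem_nhds ht.1.1 ht.1.2] with s hs
  exact (hpd s hs).1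

end LengthBound

/-! ### Matrix-valued paths -/

section Paths

theorem HasVelocity.ae_differentiableAt {ι : Type} {M : ℝ → Matrix ι ι ℂ} (h : HasVelocity M) :
    ∀ᵐ t ∂(volume.restrict (Icc (0 : ℝ) 1)), t ∈ Ioo (0 : ℝ) 1 ∧ DifferentiableAt ℝ M t := by
  obtain ⟨S, hS, hd⟩ := h
  rw [ae_restrict_iff' measurableSet_Icc]
  have h0 : ∀ᵐ t : ℝ, t ∉ S ∪ {0, 1} := by
    apply measure_eq_zero_iff_ae_notMem.1
    exact (hS.union ((Set.toFinite {0, 1}).countable)).measure_zero _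
  filter_upwards [h0] with t ht htI
  simp only [mem_union, mem_insert_iff, mem_singleton_iff, not_or] at ht
  have h1 : t ∈ Ioo (0 : ℝ) 1 :=
    ⟨lt_of_le_of_ne htI.1 (Ne.symm ht.2.1), lt_of_le_of_ne htI.2 ht.2.2⟩
  exact ⟨h1, hd t ⟨h1, ht.1⟩⟩

variable {d : ℕ}

theorem hasDerivAt_mul_mul {O : ℝ → Op d} {O' : Op d} {t : ℝ} (h : HasDerivAt O O' t)
    (K L : Op d) : HasDerivAt (fun s => K * O s * L) (K * O' * L) t := by
  rw [hasDerivAt_matrix_iff] at h ⊢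
  intro i j
  simp only [Matrix.mul_apply]
  exact HasDerivAt.fun_sum fun k _ => (HasDerivAt.fun_sum fun l _ =>
    (h l k).const_mul _).mul_const _

theorem conjDiag_apply (W : Op d) (p : Fin d → ℝ) (i j : Fin d) :
    conjDiag W p i j = ∑ k, W i k * p k * star (W j k) := by
  rw [conjDiag, Matrix.mul_apply]
  refine Finset.sum_congr rfl fun k _ => ?_
  rw [Matrix.mul_diagonal, Matrix.conjTranspose_apply]

theorem hasDerivAt_conjDiag (W : Op d) {p : ℝ → Fin d → ℝ} {p' : Fin d → ℝ} {t : ℝ}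
    (h : ∀ i, HasDerivAt (fun s => p s i) (p' i) t) :
    HasDerivAt (fun s => conjDiag W (p s)) (conjDiag W p') t := by
  rw [hasDerivAt_matrix_iff]
  intro i j
  simp only [conjDiag_apply]
  exact HasDerivAt.fun_sum fun k _ => ((h k).ofReal_comp.const_mul _).mul_const _

theorem smoothPath_conjDiag (W : Op d) {p : ℝ → Fin d → ℝ}
    (h : ∀ i, ContDiff ℝ ∞ (fun s => p s i)) : SmoothPath (fun s => conjDiag W (p s)) := by
  intro i j
  simp only [conjDiag_apply]
  refine ContDiff.contDiffOn (ContDiff.sum fun k _ => ?_)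
  exact (contDiff_const.mul (Complex.ofRealCLM.contDiff.comp (h k))).mul contDiff_const

theorem SmoothPath.continuousOn {φ : ℝ → Op d} (h : SmoothPath φ) :
    ContinuousOn φ (Icc 0 1) :=
  continuousOn_matrix_iff.2 fun i j => (h i j).continuousOn

theorem SmoothPath.differentiableAt {φ : ℝ → Op d} (h : SmoothPath φ) {t : ℝ}
    (ht : t ∈ Ioo (0 : ℝ) 1) : DifferentiableAt ℝ φ t :=
  Matrix.differentiableAt_of_hasDerivAt <|
    (hasDerivAt_matrix_iff (M' := Matrix.of fun i j => deriv (fun s => φ s i j) t)).2 fun i j =>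
      (((h i j).contDiffAt (Icc_mem_nhds ht.1 ht.2)).differentiableAt (by simp)).hasDerivAt

theorem lintegral_Icc_zero_one_const (c : ℝ≥0∞) : ∫⁻ _ in Icc (0 : ℝ) 1, c = c := by
  simp

end Paths

/-! ### The geodesic distance -/

section GeodesicDistance

variable {d : ℕ}

theorem frobNorm_log_one : frobNorm (cfc Real.log (1 : Op d)) = 0 := by
  rw [cfc_apply_one]
  simp [frobNorm]

/-- The properties of `A^{-1/2}` that make congruence by it move `A` to `𝟙`. -/
theorem invSqrt_spec {A : Op d} (hA : A.PosDef) :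
    (invSqrt A)ᴴ = invSqrt A ∧ IsUnit (invSqrt A) ∧ invSqrt A * A * invSqrt A = 1 := by
  obtain ⟨U, a, hU, hU', ha, hAa, hf⟩ := hA.exists_conjDiag
  have hUu : IsUnit U := IsUnit.of_mul_eq_one _ hU'
  have hR : invSqrt A = conjDiag U (fun i => a i ^ (-(1 / 2) : ℝ)) := hf _
  refine ⟨?_, ?_, ?_⟩
  · rw [hR]; exact conjDiag_isHermitian _ _
  · rw [hR]
    exact ((posDef_conjDiag_iff hUu).2 fun i => Real.rpow_pos_of_pos (ha i) _).isUnit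
  · rw [hR]
    conv_lhs => rw [hAa]
    rw [conjDiag_mul hU, conjDiag_mul hU]
    have : (fun i => a i ^ (-(1 / 2) : ℝ) * a i * a i ^ (-(1 / 2) : ℝ)) = fun _ => 1 := by
      ext i
      nth_rewrite 2 [← Real.rpow_one (a i)]
      rw [← Real.rpow_add (ha i), ← Real.rpow_add (ha i)]
      norm_num
    rw [this]
    simpa using conjDiag_const hU' 1

theorem le_opLength {A B : Op d} (hA : A.PosDef) {O : ℝ → Op d} (hO : IsPosDefPath A B O) :
    ENNReal.ofReal (frobNorm (cfc Real.log (invSqrt A * B * invSqrt A))) ≤ opLength O := by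
  obtain ⟨hRh, hRu, hRA⟩ := invSqrt_spec hA
  set R := invSqrt A with hR
  obtain ⟨S, hS, hd⟩ := hO.hasVelocity
  have hd' : ∀ t, DifferentiableAt ℝ O t →
      HasDerivAt (fun s => R * O s * R) (R * deriv O t * R) t := fun t ht =>
    hasDerivAt_mul_mul (Matrix.hasDerivAt_of_differentiableAt ht) R R
  have hpd : ∀ t ∈ Icc (0 : ℝ) 1, (R * O t * R).PosDef := fun t ht => by
    have := (Matrix.IsUnit.posDef_star_right_conjugate_iff hRu).2 (hO.posDef t ht)
    rwa [Matrix.star_eq_conjTranspose, hRh] at this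
  have := ofReal_frobNorm_log_le (O := fun s => R * O s * R) zero_le_one hpd
    ((continuousOn_const.mul hO.continuousOn).mul continuousOn_const) hS
    (fun t ht => Matrix.differentiableAt_of_hasDerivAt (hd' t (hd t ht)))
  simp only [hO.source, hO.target, hRA, frobNorm_log_one, ENNReal.ofReal_zero, zero_add] at this
  refine this.trans (le_of_eq (lintegral_congr_ae ?_))
  filter_upwards [hO.hasVelocity.ae_differentiableAt] with t ht
  rw [Matrix.deriv_eq_of_hasDerivAt (hd' t ht.2)]
  have := opMetric_congr hRu (O t) (deriv O t) (deriv O t)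
  rw [hRh] at this
  rw [this]

/-- The curve `A^{1/2} (A^{-1/2} B A^{-1/2})^t A^{1/2}` is a geodesic from `A` to `B`. -/
theorem exists_smooth_geodesic {A B : Op d} (hA : A.PosDef) (hB : B.PosDef) :
    ∃ O : ℝ → Op d, IsPosDefPath A B O ∧ SmoothPath O ∧
      opLength O = ENNReal.ofReal (frobNorm (cfc Real.log (invSqrt A * B * invSqrt A))) := by
  obtain ⟨hRh, hRu, hRA⟩ := invSqrt_spec hA
  set R := invSqrt A with hR
  have hC : (R * B * R).PosDef := by
    have := (Matrix.IsUnit.posDef_star_right_conjugate_iff hRu).2 hB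
    rwa [Matrix.star_eq_conjTranspose, hRh] at this
  obtain ⟨U, c, hU, hU', hc, hCc, hf⟩ := hC.exists_conjDiag
  have hUu : IsUnit U := IsUnit.of_mul_eq_one _ hU'
  have hRd := (Matrix.isUnit_iff_isUnit_det _).1 hRu
  have hR1 : R⁻¹ * R = 1 := Matrix.nonsing_inv_mul _ hRd
  have hR2 : R * R⁻¹ = 1 := Matrix.mul_nonsing_inv _ hRd
  have hRih : (R⁻¹)ᴴ = R⁻¹ := by rw [Matrix.conjTranspose_nonsing_inv, hRh]
  -- In the non-unitary frame `W = A^{1/2} U` the whole geodesic is diagonal.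
  set W := R⁻¹ * U with hW
  have hWu : IsUnit W := (IsUnit.of_mul_eq_one _ hR1).mul hUu
  have hWc : ∀ p, conjDiag W p = R⁻¹ * conjDiag U p * R⁻¹ := fun p => by
    simp only [conjDiag, hW, Matrix.conjTranspose_mul, hRih, mul_assoc]
  have hcancel : ∀ X, R⁻¹ * (R * X * R) * R⁻¹ = X := fun X => by
    calc _ = (R⁻¹ * R) * X * (R * R⁻¹) := by simp only [mul_assoc]
      _ = X := by rw [hR1, hR2, one_mul, mul_one]
  set p : ℝ → Fin d → ℝ := fun t i => Real.exp (t * Real.log (c i)) with hp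
  have hp0 : ∀ t i, 0 < p t i := fun t i => Real.exp_pos _
  have hder : ∀ t, HasDerivAt (fun s => conjDiag W (p s))
      (conjDiag W fun i => p t i * Real.log (c i)) t := fun t =>
    hasDerivAt_conjDiag W fun i => by
      simpa using ((hasDerivAt_id t).mul_const (Real.log (c i))).exp
  have hsm : SmoothPath fun t => conjDiag W (p t) := smoothPath_conjDiag W fun i => by
    simp only [hp]; fun_prop
  refine ⟨fun t => conjDiag W (p t), ⟨fun t _ => (posDef_conjDiag_iff hWu).2 (hp0 t),
    hsm.continuousOn, ⟨∅, countable_empty, fun t _ =>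
      Matrix.differentiableAt_of_hasDerivAt (hder t)⟩, ?_, ?_⟩, hsm, ?_⟩
  · have : p 0 = fun _ => 1 := by ext i; simp [hp]
    have h1 : conjDiag U (fun _ => (1 : ℝ)) = 1 := by simpa using conjDiag_const hU' 1
    rw [hWc, this, h1, ← hRA, hcancel]
  · have : p 1 = c := by ext i; simp [hp, Real.exp_log (hc i)]
    rw [hWc, this, ← hCc, hcancel]
  · rw [hf, frobNorm_conjDiag hU, opLength]
    have : ∀ t, opMetric (conjDiag W (p t)) (deriv (fun t => conjDiag W (p t)) t)
        (deriv (fun t => conjDiag W (p t)) t) = ∑ i, Real.log (c i) ^ 2 := fun t => by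
      rw [Matrix.deriv_eq_of_hasDerivAt (hder t), opMetric_conjDiag hWu fun i => (hp0 t i).ne']
      simp only [mul_div_cancel_left₀ _ (hp0 t _).ne']
    simp only [this, lintegral_Icc_zero_one_const]

theorem geodesicDist_eq {A B : Op d} (hA : A.PosDef) (hB : B.PosDef) :
    geodesicDist A B =
      ENNReal.ofReal (frobNorm (cfc Real.log (invSqrt A * B * invSqrt A))) := by
  apply le_antisymm
  · obtain ⟨O, hO, -, hl⟩ := exists_smooth_geodesic hA hB
    exact hl ▸ iInf₂_le O hO
  · exact le_iInf₂ fun O hO => le_opLength hA hO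

end GeodesicDistance

/-! ### Lifting paths of states to paths of channels -/

section Channels

variable {d : ℕ}

/-- The map `X ↦ tr(X) P`, which discards its input and prepares `P`. -/
noncomputable def replaceMap (P : Op d) : SuperOp d :=
  (Matrix.traceLinearMap (Fin d) ℂ ℂ).smulRight P

theorem replaceMap_apply (P X : Op d) : replaceMap P X = X.trace • P := rfl

theorem ampliation_id (k : ℕ) (X : BiOp k d) : ampliation k LinearMap.id X = X := rfl

theorem ampliation_add (k : ℕ) (Λ₁ Λ₂ : SuperOp d) (X : BiOp k d) :
    ampliation k (Λ₁ + Λ₂) X = ampliation k Λ₁ X + ampliation k Λ₂ X := rfl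

theorem ampliation_smul (k : ℕ) (c : ℂ) (Λ : SuperOp d) (X : BiOp k d) :
    ampliation k (c • Λ) X = c • ampliation k Λ X := rfl

/-- Amplifying `X ↦ tr(X) P` gives `tr₂(X) ⊗ P`. -/
theorem posSemidef_ampliation_replaceMap (k : ℕ) {P : Op d} (hP : P.PosSemidef) {X : BiOp k d}
    (hX : X.PosSemidef) : (ampliation k (replaceMap P) X).PosSemidef := by
  have h : ampliation k (replaceMap P) X =
      Matrix.kronecker (∑ i : Fin d, X.submatrix (fun a => (a, i)) (fun a => (a, i))) P := by
    ext p q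
    simp [ampliation, replaceMap_apply, Matrix.trace, Matrix.kronecker, Matrix.kroneckerMap_apply,
      Matrix.sum_apply]
  rw [h]
  exact (Matrix.posSemidef_sum _ fun i _ => hX.submatrix _).kronecker hP

/-- The reduced Choi matrix is the image of the maximally mixed state. -/
theorem reduced_choi (Λ : SuperOp d) : reduced (choi Λ) = Λ (maxMixed d) := by
  have h : (1 : Op d) = ∑ k : Fin d, Matrix.of fun i j =>
      Matrix.vecMulVec (omegaVec d) (star (omegaVec d)) (k, i) (k, j) := by
    ext i j
    simp [Matrix.sum_apply, Matrix.vecMulVec_apply, omegaVec, Matrix.one_apply, eq_comm]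
  rw [maxMixed, map_smul, h, map_sum, reduced]
  congr 1
  ext i j
  simp [Matrix.sum_apply, choi, ampliation]

theorem trace_maxMixed [NeZero d] : (maxMixed d).trace = 1 := by
  simp [maxMixed, NeZero.ne]

theorem natCast_smul_maxMixed [NeZero d] : (d : ℂ) • maxMixed d = 1 := by
  simp [maxMixed, smul_smul, NeZero.ne]

theorem maxMixed_posDef [NeZero d] : (maxMixed d).PosDef :=
  Matrix.PosDef.one.smul (by simpa using NeZero.pos d)

theorem IsQuantumChannel.posSemidef {Λ : SuperOp d} (hΛ : IsQuantumChannel Λ) {P : Op d}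
    (hP : P.PosSemidef) : (Λ P).PosSemidef := by
  have := (hΛ.completely_positive 1 (P.submatrix Prod.snd Prod.snd)
    (hP.submatrix _)).submatrix (fun i => ((0 : Fin 1), i))
  exact this

theorem SmoothPath.exists_frobNorm_sub_le {φ : ℝ → Op d} (hφ : SmoothPath φ) :
    ∃ C : ℝ, 0 ≤ C ∧ ∀ t ∈ Icc (0 : ℝ) 1, ∀ s ∈ Icc (0 : ℝ) 1,
      frobNorm (φ t - φ s) ≤ C * |t - s| := by
  have h : ∀ i j, ∃ K, LipschitzOnWith K (fun t => φ t i j) (Icc 0 1) := fun i j =>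
    (hφ i j).exists_lipschitzOnWith (by simp) (convex_Icc 0 1) isCompact_Icc
  choose K hK using h
  refine ⟨Real.sqrt (∑ i, ∑ j, (K i j : ℝ) ^ 2), Real.sqrt_nonneg _, fun t ht s hs => ?_⟩
  refine le_of_pow_le_pow_left₀ two_ne_zero (by positivity) ?_
  rw [frobNorm_sq_eq_sum, mul_pow, Real.sq_sqrt (by positivity), Finset.sum_mul]
  refine Finset.sum_le_sum fun i _ => ?_
  rw [Finset.sum_mul]
  refine Finset.sum_le_sum fun j _ => ?_
  rw [← mul_pow, Matrix.sub_apply]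
  gcongr
  simpa [dist_eq_norm] using (hK i j).dist_le_mul t ht s hs

/-- Near a positive definite point `φ s` of a smooth path of positive semidefinite matrices, the
weight with which `φ s` can be subtracted from `φ t` decreases at most linearly. -/
theorem SmoothPath.exists_posSemidef_sub {φ : ℝ → Op d} (hφ : SmoothPath φ)
    (hpsd : ∀ t ∈ Icc (0 : ℝ) 1, (φ t).PosSemidef) {s : ℝ} (hs : s ∈ Icc (0 : ℝ) 1)
    (hpd : (φ s).PosDef) :
    ∃ K : ℝ, ∀ t ∈ Icc (0 : ℝ) 1,
      (φ t - ((max 0 (1 - K * |t - s|) : ℝ) : ℂ) • φ s).PosSemidef := by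
  obtain ⟨C, hC, hCle⟩ := hφ.exists_frobNorm_sub_le
  obtain ⟨m, hm, hmP⟩ := hpd.exists_sub_smul_one
  -- `φ t - φ s` is at least `-C |t - s|`, and `φ s` is at least `m`.
  refine ⟨C / m, fun t ht => ?_⟩
  rcases le_total (1 - C / m * |t - s|) 0 with h | h
  · rw [max_eq_left h]
    simpa using hpsd t ht
  · rw [max_eq_right h]
    have h1 := posSemidef_add_smul_one ((hpsd t ht).1.sub (hpsd s hs).1) (hCle t ht s hs)
    have h2 := hmP.smul (a := ((C / m * |t - s| : ℝ) : ℂ))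
      (by exact_mod_cast (by positivity : 0 ≤ C / m * |t - s|))
    convert h1.add h2 using 1
    have h3 : C * |t - s| = C / m * |t - s| * m := by field_simp
    rw [h3, smul_sub, smul_smul]
    push_cast
    module

/-- A smooth path of full-rank states from `𝟙/d` to `Λ(𝟙/d)` lifts to a path of channels from `Id`
to `Λ`. The lift is `(1 - t) λₜ Id + t μₜ Λ` with continuous `λₜ`, `μₜ` such that `λ₀ = μ₁ = 1`,
`λₜ 𝟙/d ≤ φₜ` and `μₜ Λ(𝟙/d) ≤ φₜ`, completed by the map preparing the rest of `φₜ`. -/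
theorem exists_isChannelPath [NeZero d] {Λ : SuperOp d} (hΛ : IsQuantumChannel Λ)
    {φ : ℝ → Op d} (hφ : SmoothPath φ)
    (hst : ∀ t ∈ Icc (0 : ℝ) 1, (φ t).PosDef ∧ (φ t).trace = 1)
    (h0 : φ 0 = maxMixed d) (h1 : φ 1 = Λ (maxMixed d)) :
    ∃ Γ : ℝ → SuperOp d, IsChannelPath LinearMap.id Λ Γ ∧
      (HasVelocity fun t => choi (Γ t)) ∧ ∀ t ∈ Icc (0 : ℝ) 1, Γ t (maxMixed d) = φ t := by
  have m0 : (0 : ℝ) ∈ Icc (0 : ℝ) 1 := by simp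
  have m1 : (1 : ℝ) ∈ Icc (0 : ℝ) 1 := by simp
  obtain ⟨K₀, hK₀⟩ := hφ.exists_posSemidef_sub (fun t ht => (hst t ht).1.posSemidef) m0 (hst 0 m0).1
  obtain ⟨K₁, hK₁⟩ := hφ.exists_posSemidef_sub (fun t ht => (hst t ht).1.posSemidef) m1 (hst 1 m1).1
  set l : ℝ → ℝ := fun t => max 0 (1 - K₀ * |t - 0|) with hl
  set m : ℝ → ℝ := fun t => max 0 (1 - K₁ * |t - 1|) with hm
  set Q : ℝ → Op d := fun t =>
    φ t - (((1 - t) * l t : ℝ) : ℂ) • φ 0 - ((t * m t : ℝ) : ℂ) • φ 1 with hQ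
  set Γ : ℝ → SuperOp d := fun t =>
    (((1 - t) * l t : ℝ) : ℂ) • LinearMap.id + ((t * m t : ℝ) : ℂ) • Λ + replaceMap (Q t) with hΓ
  have hQpsd : ∀ t ∈ Icc (0 : ℝ) 1, (Q t).PosSemidef := by
    intro t ht
    have a0 := (hK₀ t ht).smul (a := ((1 - t : ℝ) : ℂ)) (by exact_mod_cast sub_nonneg.2 ht.2)
    have a1 := (hK₁ t ht).smul (a := ((t : ℝ) : ℂ)) (by exact_mod_cast ht.1)
    convert a0.add a1 using 1
    simp only [hQ, hl, hm, smul_sub, smul_smul]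
    push_cast
    module
  have hentry : ∀ t p q, choi (Γ t) p q =
      (((1 - t) * l t : ℝ) : ℂ) * choi LinearMap.id p q + ((t * m t : ℝ) : ℂ) * choi Λ p q +
        (Matrix.of fun i j => Matrix.vecMulVec (omegaVec d)
          (star (omegaVec d)) (p.1, i) (q.1, j)).trace * Q t p.2 q.2 := by
    intro t p q
    simp [hΓ, choi, ampliation, replaceMap_apply]
  have hlc : Continuous l := by simp only [hl]; fun_prop
  have hmc : Continuous m := by simp only [hm]; fun_prop
  refine ⟨Γ, ⟨fun t ht => ⟨fun k X hX => ?_, fun X => ?_⟩, ?_, ?_, ?_⟩, ?_, fun t ht => ?_⟩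
  · simp only [hΓ, ampliation_add, ampliation_smul, ampliation_id]
    refine ((hX.smul ?_).add ((hΛ.completely_positive k X hX).smul ?_)).add
      (posSemidef_ampliation_replaceMap k (hQpsd t ht) hX)
    · exact_mod_cast mul_nonneg (sub_nonneg.2 ht.2) (le_max_left _ _)
    · exact_mod_cast mul_nonneg ht.1 (le_max_left _ _)
  · have : (Q t).trace = 1 - (((1 - t) * l t : ℝ) : ℂ) - ((t * m t : ℝ) : ℂ) := by
      simp only [hQ, Matrix.trace_sub, Matrix.trace_smul, (hst t ht).2, (hst 0 m0).2,
        (hst 1 m1).2, smul_eq_mul, mul_one]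
    simp only [hΓ, LinearMap.add_apply, LinearMap.smul_apply, LinearMap.id_apply,
      replaceMap_apply, Matrix.trace_add, Matrix.trace_smul, hΛ.trace_preserving, this, smul_eq_mul]
    ring
  · rw [continuousOn_matrix_iff]
    intro p q
    simp only [hentry]
    have := continuousOn_matrix_iff.1 hφ.continuousOn
    simp only [hQ, Matrix.sub_apply, Matrix.smul_apply]
    fun_prop
  · have : Q 0 = 0 := by simp [hQ, hl]
    simp [hΓ, this, hl, replaceMap]
  · have : Q 1 = 0 := by simp [hQ, hm]
    simp [hΓ, this, hm, replaceMap]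
  · -- The only corners are where `l` and `m` reach `0`.
    refine ⟨{K₀⁻¹, 1 - K₁⁻¹}, (Set.toFinite _).countable, fun t ht => ?_⟩
    have ht' := ht.2
    simp only [mem_insert_iff, mem_singleton_iff, not_or] at ht'
    have hmax : ∀ {f : ℝ → ℝ}, Differentiable ℝ f → f t ≠ 0 →
        DifferentiableAt ℝ (fun s => max 0 (f s)) t := by
      intro f hf hft
      rcases lt_or_gt_of_ne hft with h | h
      · refine (differentiableAt_const (0 : ℝ)).congr_of_eventuallyEq ?_
        filter_upwards [hf.continuous.continuousAt.eventually_lt continuousAt_const h] with s hs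
        exact max_eq_left hs.le
      · refine hf.differentiableAt.congr_of_eventuallyEq ?_
        filter_upwards [hf.continuous.continuousAt.eventually_const_lt h] with s hs
        exact max_eq_right hs.le
    have hld : DifferentiableAt ℝ l t := by
      have h : DifferentiableAt ℝ (fun s => max 0 (1 - K₀ * s)) t := by
        refine hmax (by fun_prop) fun h => ht'.1 ?_
        exact eq_inv_of_mul_eq_one_right (by linarith)
      refine h.congr_of_eventuallyEq ?_
      filter_upwards [Ioi_mem_nhds ht.1.1] with s hs
      simp only [hl]
      rw [sub_zero, abs_of_pos hs]
    have hmd : DifferentiableAt ℝ m t := by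
      have h : DifferentiableAt ℝ (fun s => max 0 (1 - K₁ * (1 - s))) t := by
        refine hmax (by fun_prop) fun h => ht'.2 ?_
        have := eq_inv_of_mul_eq_one_right (a := K₁) (b := 1 - t) (by linarith)
        linarith
      refine h.congr_of_eventuallyEq ?_
      filter_upwards [Iio_mem_nhds ht.1.2] with s hs
      simp only [hm]
      rw [abs_of_neg (sub_neg.2 hs), neg_sub]
    have hφd := hasDerivAt_matrix_iff.1
      (Matrix.hasDerivAt_of_differentiableAt (hφ.differentiableAt ht.1))
    refine Matrix.differentiableAt_of_hasDerivAt
      (M' := Matrix.of fun p q => deriv (fun s => choi (Γ s) p q) t)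
      (hasDerivAt_matrix_iff.2 fun p q => DifferentiableAt.hasDerivAt ?_)
    simp only [hentry]
    have hφe : ∀ i j, DifferentiableAt ℝ (fun s => φ s i j) t := fun i j =>
      (hφd i j).differentiableAt
    simp only [hQ, Matrix.sub_apply, Matrix.smul_apply]
    have hl' : DifferentiableAt ℝ (fun s => (((1 - s) * l s : ℝ) : ℂ)) t :=
      (((differentiableAt_const 1).sub differentiableAt_id).mul hld).hasDerivAt.ofReal_comp
        |>.differentiableAt
    have hm' : DifferentiableAt ℝ (fun s => ((s * m s : ℝ) : ℂ)) t :=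
      (differentiableAt_id.mul hmd).hasDerivAt.ofReal_comp.differentiableAt
    have := hφe p.2 q.2
    fun_prop
  · simp only [hΓ, hQ, LinearMap.add_apply, LinearMap.smul_apply, LinearMap.id_apply,
      replaceMap_apply, trace_maxMixed, h0, h1, one_smul]
    abel

end Channels

/-! ### Lower bound for the complexity -/

section LowerBound

variable {d : ℕ}

theorem continuousOn_reduced {M : ℝ → BiOp d d} {s : Set ℝ} (h : ContinuousOn M s) :
    ContinuousOn (fun t => reduced (M t)) s := by
  rw [continuousOn_matrix_iff] at h ⊢
  intro i j
  simp only [reduced, Matrix.smul_apply, Matrix.of_apply]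
  fun_prop

theorem hasDerivAt_reduced {M : ℝ → BiOp d d} {M' : BiOp d d} {t : ℝ} (h : HasDerivAt M M' t) :
    HasDerivAt (fun s => reduced (M s)) (reduced M') t := by
  rw [hasDerivAt_matrix_iff] at h ⊢
  intro i j
  simp only [reduced, Matrix.smul_apply, Matrix.of_apply, smul_eq_mul]
  exact (HasDerivAt.fun_sum fun k _ => h (k, i) (k, j)).const_mul _

theorem Matrix.hasDerivAt_const_smul {O : ℝ → Op d} {O' : Op d} {t : ℝ} (h : HasDerivAt O O' t)
    (c : ℂ) : HasDerivAt (fun s => c • O s) (c • O') t := by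
  rw [hasDerivAt_matrix_iff] at h ⊢
  exact fun i j => (h i j).const_mul c

/-- The determinant of a positive definite matrix is bounded below in terms of `‖log P‖_F`. -/
theorem exp_le_det {P : Op d} (hP : P.PosDef) {L : ℝ} (hL : frobNorm (cfc Real.log P) ≤ L) :
    Real.exp (-(d * L)) ≤ P.det.re := by
  obtain ⟨U, a, hU, hU', ha, hPa, hf⟩ := hP.exists_conjDiag
  have hdet : P.det = ((∏ i, a i : ℝ) : ℂ) := by
    rw [hPa, conjDiag, Matrix.det_mul_comm, ← mul_assoc, hU, one_mul, Matrix.det_diagonal]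
    push_cast
    rfl
  rw [hf, frobNorm_conjDiag hU] at hL
  rw [hdet, Complex.ofReal_re]
  have h1 : ∀ i, -L ≤ Real.log (a i) := fun i => by
    have : |Real.log (a i)| ≤ Real.sqrt (∑ i, Real.log (a i) ^ 2) :=
      Real.abs_le_sqrt (Finset.single_le_sum (f := fun i => Real.log (a i) ^ 2)
        (fun _ _ => sq_nonneg _) (Finset.mem_univ i))
    linarith [neg_abs_le (Real.log (a i))]
  calc Real.exp (-(d * L)) = ∏ _i : Fin d, Real.exp (-L) := by
        rw [← Real.exp_sum]; simp
    _ ≤ ∏ i, a i := Finset.prod_le_prod (fun _ _ => (Real.exp_pos _).le) fun i _ => by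
        rw [← Real.exp_log (ha i)]
        exact Real.exp_le_exp.2 (h1 i)

/-- A continuous function on `[0, 1]` that stays above `c > 0` as long as it is positive never
vanishes. -/
theorem pos_of_forall_pos_imp_le {f : ℝ → ℝ} (hf : ContinuousOn f (Icc 0 1)) (h0 : 0 < f 0)
    {c : ℝ} (hc : 0 < c) (h : ∀ s ∈ Icc (0 : ℝ) 1, (∀ r ∈ Icc 0 s, 0 < f r) → c ≤ f s) :
    ∀ s ∈ Icc (0 : ℝ) 1, 0 < f s := by
  by_contra! hcon
  obtain ⟨s₁, hs₁, hfs₁⟩ := hcon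
  -- At the first zero `f` would be both nonpositive and a limit of values `≥ c`.
  set Z := Icc (0 : ℝ) 1 ∩ f ⁻¹' Iic 0 with hZ
  have hZc : IsCompact Z :=
    isCompact_Icc.of_isClosed_subset (hf.preimage_isClosed_of_isClosed isClosed_Icc isClosed_Iic)
      inter_subset_left
  obtain ⟨s₀, hs₀, hmin⟩ := hZc.exists_isLeast ⟨s₁, hs₁, hfs₁⟩
  have hpos : ∀ r ∈ Ico 0 s₀, 0 < f r := fun r hr => by
    by_contra! hle
    exact absurd (hmin ⟨⟨hr.1, hr.2.le.trans hs₀.1.2⟩, hle⟩) (not_le.2 hr.2)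
  have hs₀' : 0 < s₀ := lt_of_le_of_ne hs₀.1.1 fun h => absurd hs₀.2 (by
    rw [← h]; simpa using h0)
  have hlim : Filter.Tendsto f (nhdsWithin s₀ (Ico 0 s₀)) (nhds (f s₀)) :=
    (hf s₀ hs₀.1).mono fun r hr => ⟨hr.1, hr.2.le.trans hs₀.1.2⟩
  have hne : (nhdsWithin s₀ (Ico 0 s₀)).NeBot := by
    rw [nhdsWithin_Ico_eq_nhdsLT hs₀']; infer_instance
  have : c ≤ f s₀ := ge_of_tendsto hlim <| by
    filter_upwards [self_mem_nhdsWithin] with r hr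
    exact h r ⟨hr.1, hr.2.le.trans hs₀.1.2⟩ fun q hq => hpos q ⟨hq.1, hq.2.trans_lt hr.2⟩
  exact absurd hs₀.2 (not_le.2 (hc.trans_le this))

theorem cfc_log_natCast_smul [NeZero d] {P : Op d} (hP : P.PosDef) :
    cfc Real.log ((d : ℂ) • P) = ((Real.log d : ℝ) : ℂ) • (1 : Op d) + cfc Real.log P := by
  obtain ⟨U, a, hU, hU', ha, hPa, hf⟩ := hP.exists_conjDiag
  have h1 : (d : ℂ) • P = (d : ℝ) • P := by ext i j; simp
  -- Every function is continuous on the finite spectrum.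
  have h2 : ((fun x => (d : ℝ) * x) '' spectrum ℝ P).Finite :=
    Matrix.finite_real_spectrum.image _
  have h3 : cfc (fun x => Real.log (d * x)) P = cfc Real.log ((d : ℝ) • P) :=
    cfc_comp_const_mul (d : ℝ) Real.log P (h2.continuousOn _) hP.1
  rw [h1, ← h3, hf, hf, ← conjDiag_const hU', conjDiag_add]
  congr 1
  ext i
  exact Real.log_mul (by simp [NeZero.ne]) (ha i).ne'

/-- A path of channels of finite length never meets a singular state, and its length bounds
`‖log‖_F` of the final rescaled state. -/
theorem logNorm_le_choiLength [NeZero d] {Λ : SuperOp d} {Γ : ℝ → SuperOp d}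
    (hΓ : IsChannelPath LinearMap.id Λ Γ) (hv : HasVelocity fun t => choi (Γ t)) :
    logNorm Λ ≤ choiLength fun t => choi (Γ t) := by
  rcases eq_or_ne (choiLength fun t => choi (Γ t)) ⊤ with htop | hfin
  · rw [htop]; exact le_top
  have hd0 : (d : ℂ) ≠ 0 := by simp [NeZero.ne]
  set O : ℝ → Op d := fun t => (d : ℂ) • Γ t (maxMixed d) with hO
  have hOr : ∀ t, O t = (d : ℂ) • reduced (choi (Γ t)) := fun t => by rw [reduced_choi]
  have hOc : ContinuousOn O (Icc 0 1) := by
    simp only [hO, ← reduced_choi]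
    exact (continuousOn_reduced hΓ.continuousOn).const_smul (d : ℂ)
  have hOd : ∀ t, DifferentiableAt ℝ (fun t => choi (Γ t)) t →
      HasDerivAt O ((d : ℂ) • reduced (deriv (fun t => choi (Γ t)) t)) t := fun t ht => by
    simp only [hO, ← reduced_choi]
    exact Matrix.hasDerivAt_const_smul
      (hasDerivAt_reduced (Matrix.hasDerivAt_of_differentiableAt ht)) _
  have hOpsd : ∀ t ∈ Icc (0 : ℝ) 1, (O t).PosSemidef := fun t ht =>
    ((hΓ.channel t ht).posSemidef maxMixed_posDef.posSemidef).smul (by simp)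
  have hO0 : O 0 = 1 := by simp only [hO, hΓ.source, LinearMap.id_apply, natCast_smul_maxMixed]
  have hbound : ∀ s ∈ Icc (0 : ℝ) 1, (∀ r ∈ Icc 0 s, (O r).PosDef) →
      ENNReal.ofReal (frobNorm (cfc Real.log (O s))) ≤ choiLength fun t => choi (Γ t) := by
    intro s hs hpd
    obtain ⟨S, hS, hd⟩ := hv
    have h1 := ofReal_frobNorm_log_le hs.1 hpd (hOc.mono (Icc_subset_Icc_right hs.2)) hS
      fun t ht => Matrix.differentiableAt_of_hasDerivAt
        (hOd t (hd t ⟨Ioo_subset_Ioo_right hs.2 ht.1, ht.2⟩))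
    rw [hO0, frobNorm_log_one, ENNReal.ofReal_zero, zero_add] at h1
    refine (h1.trans (lintegral_mono_set (Icc_subset_Icc_right hs.2))).trans
      (lintegral_mono_ae ?_)
    filter_upwards [HasVelocity.ae_differentiableAt ⟨S, hS, hd⟩] with t ht
    rw [choiSpeed]
    split_ifs
    · rw [Matrix.deriv_eq_of_hasDerivAt (hOd t ht.2), hOr, opMetric_smul hd0]
      rfl
    · exact le_top
  have hdetpos : ∀ t ∈ Icc (0 : ℝ) 1, 0 < (O t).det.re → (O t).PosDef := fun t ht h =>
    (hOpsd t ht).posDef_iff_det_ne_zero.2 fun h0 => by simp [h0] at h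
  have hpos := pos_of_forall_pos_imp_le (f := fun t => (O t).det.re)
    (Complex.continuous_re.comp_continuousOn (continuous_id.matrix_det.comp_continuousOn hOc))
    (by simp [hO0]) (Real.exp_pos (-(d * (choiLength fun t => choi (Γ t)).toReal)))
    fun s hs h => by
      have hpd : ∀ r ∈ Icc 0 s, (O r).PosDef := fun r hr =>
        hdetpos r ⟨hr.1, hr.2.trans hs.2⟩ (h r hr)
      exact exp_le_det (hpd s ⟨hs.1, le_rfl⟩)
        ((ENNReal.ofReal_le_iff_le_toReal hfin).1 (hbound s hs hpd))
  have hpd : ∀ t ∈ Icc (0 : ℝ) 1, (O t).PosDef := fun t ht => hdetpos t ht (hpos t ht)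
  have m1 : (1 : ℝ) ∈ Icc (0 : ℝ) 1 := by simp
  have hΛpd : (Λ (maxMixed d)).PosDef := by
    have := ((hOpsd 1 m1).posDef_iff_det_ne_zero.1 (hpd 1 m1))
    refine ((hΓ.target ▸ hΓ.channel 1 m1).posSemidef
      maxMixed_posDef.posSemidef).posDef_iff_det_ne_zero.2 fun h => this ?_
    simp only [hO, hΓ.target, Matrix.det_smul, h, mul_zero]
  have := hbound 1 m1 hpd
  rw [logNorm, if_pos hΛpd, ← cfc_log_natCast_smul hΛpd]
  simpa only [hO, hΓ.target] using this

end LowerBound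

/-! ### Upper bound for the complexity -/

section UpperBound

variable {d : ℕ}

/-- Subtracting a weighted mean of the `hᵢ` from each of them increases the Euclidean norm by at
most the factor `√d + 1`. -/
theorem sqrt_sum_sub_mean_sq_le {h p : Fin d → ℝ} (hp : ∀ i, 0 ≤ p i) (hp1 : ∑ i, p i = 1) :
    Real.sqrt (∑ i, (h i - ∑ j, p j * h j) ^ 2) ≤
      (Real.sqrt d + 1) * Real.sqrt (∑ i, h i ^ 2) := by
  set ℓ := Real.sqrt (∑ i, h i ^ 2) with hℓ
  set m := ∑ j, p j * h j with hm
  have hℓ0 : 0 ≤ ℓ := Real.sqrt_nonneg _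
  have hℓ2 : ℓ ^ 2 = ∑ i, h i ^ 2 := Real.sq_sqrt (Finset.sum_nonneg fun _ _ => sq_nonneg _)
  have hd2 : Real.sqrt d ^ 2 = d := Real.sq_sqrt (Nat.cast_nonneg d)
  have hd0 : 0 ≤ Real.sqrt d := Real.sqrt_nonneg _
  have hmle : |m| ≤ ℓ := by
    calc |m| ≤ ∑ j, p j * ℓ := by
          refine (Finset.abs_sum_le_sum_abs _ _).trans (Finset.sum_le_sum fun j _ => ?_)
          rw [abs_mul, abs_of_nonneg (hp j)]
          refine mul_le_mul_of_nonneg_left (Real.abs_le_sqrt ?_) (hp j)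
          exact Finset.single_le_sum (f := fun i => h i ^ 2) (fun _ _ => sq_nonneg _)
            (Finset.mem_univ j)
      _ = ℓ := by rw [← Finset.sum_mul, hp1, one_mul]
  have hsum : |∑ i, h i| ≤ Real.sqrt d * ℓ := by
    rw [hℓ, ← Real.sqrt_mul (Nat.cast_nonneg d)]
    apply Real.abs_le_sqrt
    simpa using sq_sum_le_card_mul_sum_sq (s := Finset.univ) (f := h)
  have hexp : ∑ i, (h i - m) ^ 2 = ℓ ^ 2 - 2 * (m * ∑ i, h i) + d * m ^ 2 := by
    simp only [sub_sq, Finset.sum_add_distrib, Finset.sum_sub_distrib, hℓ2, Finset.mul_sum]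
    simp
    exact Finset.sum_congr rfl fun i _ => by ring
  rw [Real.sqrt_le_left (by positivity), hexp]
  have h1 : -(m * ∑ i, h i) ≤ ℓ * (Real.sqrt d * ℓ) := by
    refine (neg_le_abs _).trans ?_
    rw [abs_mul]
    gcongr
  have h2 : d * m ^ 2 ≤ d * ℓ ^ 2 := by
    rw [← sq_abs m]
    gcongr
  calc _ ≤ ℓ ^ 2 + 2 * (ℓ * (Real.sqrt d * ℓ)) + d * ℓ ^ 2 := by linarith
    _ = ((Real.sqrt d + 1) * ℓ) ^ 2 := by rw [mul_pow, add_sq, hd2]; ring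

/-- The logarithmic derivative of the softmax weights of `t h` is the deviation of `h` from its
weighted mean. -/
theorem hasDerivAt_softmax (h : Fin d → ℝ) [NeZero d] (i : Fin d) (t : ℝ) :
    HasDerivAt (fun s => Real.exp (s * h i) / ∑ j, Real.exp (s * h j))
      (Real.exp (t * h i) / (∑ j, Real.exp (t * h j)) *
        (h i - ∑ j, Real.exp (t * h j) / (∑ k, Real.exp (t * h k)) * h j)) t := by
  have he : ∀ j, HasDerivAt (fun s => Real.exp (s * h j)) (Real.exp (t * h j) * h j) t :=
    fun j => by simpa using ((hasDerivAt_id t).mul_const (h j)).exp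
  have hZ : 0 < ∑ j, Real.exp (t * h j) :=
    Finset.sum_pos (fun _ _ => Real.exp_pos _) Finset.univ_nonempty
  refine ((he i).div (HasDerivAt.fun_sum fun j (_ : j ∈ Finset.univ) => he j)
    hZ.ne').congr_deriv ?_
  have : ∑ j, Real.exp (t * h j) / (∑ k, Real.exp (t * h k)) * h j =
      (∑ j, Real.exp (t * h j) * h j) / ∑ k, Real.exp (t * h k) := by
    rw [Finset.sum_div]
    exact Finset.sum_congr rfl fun j _ => by ring
  rw [this]
  field_simp

/-- The length of a path of channels depends only on the path of the states `Λₜ(𝟙/d)`. -/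
theorem choiLength_le_of_speed_le {Γ : ℝ → SuperOp d} {φ : ℝ → Op d}
    (hv : HasVelocity fun t => choi (Γ t)) (hφ : ∀ t ∈ Icc (0 : ℝ) 1, Γ t (maxMixed d) = φ t)
    (hpd : ∀ t ∈ Icc (0 : ℝ) 1, (φ t).PosDef) {c : ℝ}
    (hc : ∀ t ∈ Ioo (0 : ℝ) 1, Real.sqrt (opMetric (φ t) (deriv φ t) (deriv φ t)) ≤ c) :
    choiLength (fun t => choi (Γ t)) ≤ ENNReal.ofReal c := by
  rw [← lintegral_Icc_zero_one_const (ENNReal.ofReal c)]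
  refine lintegral_mono_ae ?_
  filter_upwards [hv.ae_differentiableAt] with t ht
  have htI := Ioo_subset_Icc_self ht.1
  have hred : reduced (choi (Γ t)) = φ t := by rw [reduced_choi, hφ t htI]
  have hder : deriv φ t = reduced (deriv (fun t => choi (Γ t)) t) := by
    have h1 := hasDerivAt_reduced (Matrix.hasDerivAt_of_differentiableAt ht.2)
    refine Matrix.deriv_eq_of_hasDerivAt 
      (HasDerivAt.congr_of_eventuallyEq (F := Fin d → Fin d → ℂ) h1 ?_)
    filter_upwards [Icc_mem_nhds ht.1.1 ht.1.2] with s hs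
    rw [reduced_choi, hφ s hs]
  rw [choiSpeed, if_pos (hred ▸ hpd t htI), choiMetric, hred, ← hder]
  exact ENNReal.ofReal_le_ofReal (hc t ht.1)

/-- The geodesic `t ↦ (d Λ(𝟙/d))ᵗ`, normalized to unit trace, lifts to a path of channels of
length at most `(√d + 1) ℓ`. -/
theorem complexity_le [NeZero d] {Λ : SuperOp d} (hΛ : IsQuantumChannel Λ) :
    complexity Λ ≤ ENNReal.ofReal (Real.sqrt d + 1) * logNorm Λ := by
  by_cases hpd : (Λ (maxMixed d)).PosDef
  swap
  · rw [logNorm, if_neg hpd, ENNReal.mul_top]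
    · exact le_top
    · simp only [ne_eq, ENNReal.ofReal_eq_zero, not_le]
      positivity
  obtain ⟨U, a, hU, hU', ha, hΛa, hf⟩ := hpd.exists_conjDiag
  have hUu : IsUnit U := IsUnit.of_mul_eq_one _ hU'
  have hdpos : (0 : ℝ) < d := by exact_mod_cast NeZero.pos d
  have hasum : ∑ i, a i = 1 := by
    have := hΛ.trace_preserving (maxMixed d)
    rw [trace_maxMixed, hΛa, trace_conjDiag hU] at this
    exact_mod_cast this
  set h : Fin d → ℝ := fun i => Real.log d + Real.log (a i) with hh
  set p : ℝ → Fin d → ℝ := fun t i => Real.exp (t * h i) / ∑ j, Real.exp (t * h j) with hp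
  have hZ : ∀ t, 0 < ∑ j, Real.exp (t * h j) := fun t =>
    Finset.sum_pos (fun _ _ => Real.exp_pos _) Finset.univ_nonempty
  have hp0 : ∀ t i, 0 < p t i := fun t i => div_pos (Real.exp_pos _) (hZ t)
  have hp1 : ∀ t, ∑ i, p t i = 1 := fun t => by
    rw [← Finset.sum_div, div_self (hZ t).ne']
  have hpst : p 0 = fun _ => (d : ℝ)⁻¹ := by ext i; simp [hp]
  have hpend : p 1 = a := by
    have he : ∀ i, Real.exp (h i) = d * a i := fun i => by
      rw [hh, Real.exp_add, Real.exp_log hdpos, Real.exp_log (ha i)]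
    ext i
    simp only [hp, one_mul, he, ← Finset.mul_sum, hasum, mul_one]
    field_simp
  set φ : ℝ → Op d := fun t => conjDiag U (p t) with hφ
  have hsm : SmoothPath φ := smoothPath_conjDiag U fun i => by
    refine ContDiff.div (by fun_prop) (by fun_prop) fun t => (hZ t).ne'
  have hφpd : ∀ t, (φ t).PosDef := fun t => (posDef_conjDiag_iff hUu).2 (hp0 t)
  obtain ⟨Γ, hΓ, hv, hΓφ⟩ := exists_isChannelPath hΛ hsm
    (fun t _ => ⟨hφpd t, by rw [hφ, trace_conjDiag hU, hp1, Complex.ofReal_one]⟩)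
    (by rw [hφ]; simp only [hpst, conjDiag_const hU']; simp [maxMixed])
    (by rw [hφ]; simp only [hpend, ← hΛa])
  have hℓ : frobNorm (((Real.log d : ℝ) : ℂ) • (1 : Op d) + cfc Real.log (Λ (maxMixed d))) =
      Real.sqrt (∑ i, h i ^ 2) := by
    rw [hf, ← conjDiag_const hU', conjDiag_add, frobNorm_conjDiag hU]
  rw [logNorm, if_pos hpd, ← ENNReal.ofReal_mul (by positivity), hℓ]
  refine (iInf_le_of_le Γ (iInf₂_le hΓ hv)).trans
    (choiLength_le_of_speed_le hv hΓφ (fun t _ => hφpd t) fun t _ => ?_)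
  rw [Matrix.deriv_eq_of_hasDerivAt (hasDerivAt_conjDiag U fun i => hasDerivAt_softmax h i t),
    opMetric_conjDiag hUu fun i => (hp0 t i).ne']
  refine le_trans (le_of_eq ?_) (sqrt_sum_sub_mean_sq_le (h := h) (fun i => (hp0 t i).le) (hp1 t))
  congr 1
  refine Finset.sum_congr rfl fun i _ => ?_
  rw [mul_div_cancel_left₀ _ (hp0 t i).ne']

end UpperBound

theorem mainTheorem8 (d : ℕ) [NeZero d] :
    (∀ Λ : SuperOp d, IsQuantumChannel Λ →
      logNorm Λ ≤ complexity Λ ∧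
        complexity Λ ≤ ENNReal.ofReal (Real.sqrt d + 1) * logNorm Λ) ∧
    (∀ A B : Op d, A.PosDef → B.PosDef →
      geodesicDist A B =
          ENNReal.ofReal (frobNorm (cfc Real.log (invSqrt A * B * invSqrt A))) ∧
        ∃ O : ℝ → Op d, IsPosDefPath A B O ∧ SmoothPath O ∧ opLength O = geodesicDist A B) ∧
    (∀ Λ : SuperOp d, IsQuantumChannel Λ → (Λ (maxMixed d)).PosDef →
      ∀ φ : ℝ → Op d, SmoothPath φ →
        (∀ t ∈ Set.Icc (0 : ℝ) 1, (φ t).PosDef ∧ (φ t).trace = 1) →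
        φ 0 = maxMixed d → φ 1 = Λ (maxMixed d) →
        ∃ Γ : ℝ → SuperOp d, IsChannelPath LinearMap.id Λ Γ ∧
          ∀ t ∈ Set.Icc (0 : ℝ) 1, Γ t (maxMixed d) = φ t) := by
  refine ⟨fun Λ hΛ => ⟨?_, complexity_le hΛ⟩, fun A B hA hB => ⟨geodesicDist_eq hA hB, ?_⟩,
    fun Λ hΛ _ φ hφ hst h0 h1 => ?_⟩
  · exact le_iInf fun Γ => le_iInf fun hΓ => le_iInf fun hv => logNorm_le_choiLength hΓ hv
  · obtain ⟨O, hO, hsm, hl⟩ := exists_smooth_geodesic hA hB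
    exact ⟨O, hO, hsm, hl.trans (geodesicDist_eq hA hB).symm⟩
  · obtain ⟨Γ, hΓ, -, hΓφ⟩ := exists_isChannelPath hΛ hφ hst h0 h1
    exact ⟨Γ, hΓ, hΓφ⟩
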